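/- Throughout, a toric variety $X$ over $\mathbb{C}$ is given by its fan $\Delta$, a fan of rational strongly convex polyhedral cones in $N_{\mathbb{R}}=N\otimes_{\mathbb{Z}}\mathbb{R}$ for a lattice $N\cong\mathbb{Z}^n$. We use the usual dictionary between toric geometry and fans: - $X$ is complete if the cones of $\Delta$ cover $N_{\mathbb{R}}$, and nonsingular if every cone is generated by part of a $\mathbb{Z}$-basis of $N$. - A toric (torus-invariant prime) divisor $D$ is given by its ray generator $\rho\in N$, the generator of the semigroup of lattice points of a one-dimensional cone of $\Delta$. - A complete nonsingular $X$ is Fano if $-K_X=\sum_\rho D_\rho$ is ample, i.e. if the function $\psi$ on $N_{\mathbb{R}}$ that is linear on the cones of $\Delta$ and satisfies $\psi(\rho)=-1$ for all ray generators $\rho$ is strictly convex: for each full-dimensional $\sigma\in\Delta$, the linear function that agrees with $\psi$ on $\sigma$ is strictly greater than $\psi$ outside $\sigma$. - The irreducible toric subvarieties $X(\sigma)$ of $X$ correspond to the cones $\sigma\in\Delta$; the fan of $X(\sigma)$ is the star $\Delta(\sigma)$, which consists of the images in $(N/\langle\sigma\rangle)_{\mathbb{R}}$ of the cones of $\Delta$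 containing $\sigma$, where $\langle\sigma\rangle$ is the sublattice generated by $\sigma\cap N$. - $X\to X'$ is the blow-down of a toric divisor if $X'$ is a nonsingular toric variety, with fan $\Delta'$ in $N_{\mathbb{R}}$, and $X\to X'$ is the blow-up of an irreducible toric subvariety $X'(\sigma)$, where $\sigma=\langle\rho_1,\dots,\rho_k\rangle\in\Delta'$ and $k\ge 2$; i.e. $\Delta$ is the star subdivision of $\Delta'$ along $\sigma$. The exceptional divisor, which is the divisor that is blown down, has ray generator $\rho_1+\cdots+\rho_k$. - A set of toric divisors $\{D_1,\dots,D_k\}$ with ray generators $\rho_1,\dots,\rho_k$ is a primitive set if $\langle\rho_1,\dots,\rho_k\rangle\notin\Delta$ but $\langle\rho_1,\dots,\widehat{\rho_j},\dots,\rho_k\rangle\in\Delta$ for every $j$. **Theorem.** Let $X$ be a complete nonsingular toric variety with fan $\Delta$. The following are equivalent. (i) $X$ is Fano, every toric subvariety of $X$ is Fano, and every nonsingular toric variety $X'$ such that $X\to X'$ is the blow-down of a toric divisor is Fano. (ii) For every primitive set $\{D_1,\dots,D_k\}$, either $\rho_1+\cdots+\rho_k=0$ or $\rho_1+\cdots+\rho_k=\rho'$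 for some ray generator $\rho'$ of $\Delta$; and every ray generator $\rho'$ is equal to $\rho_1+\cdots+\rho_j$ for at most one primitive set $\{D_1,\dots,D_j\}$. Moreover, if $X$ satisfies (i) and (ii), then $X$ is an iterated blow-up of a product of projective spaces along irreducible toric subvarieties, such that the exceptional divisors can be blown down in any order and every intermediate blow-up is a toric variety satisfying (i) and (ii). Precisely: there is a toric variety $X_0$, isomorphic to a product of projective spaces and with fan $\Delta_0$ in $N_{\mathbb{R}}$, such that for every enumeration $\rho_1,\dots,\rho_r$, without repetitions, of the ray generators of $\Delta$ that are not ray generators of $\Delta_0$ there is a sequence $X=Y_0\to Y_1\to\cdots\to Y_r=X_0$ of complete nonsingular toric varieties, all of them satisfying (i) and (ii), in which each $Y_{i-1}\to Y_i$ is the blow-down of the toric divisor with ray generator $\rho_i$. -/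

import Mathlib

open scoped TensorProduct

noncomputable section

namespace ToricFan

/-! Toric varieties over the complex numbers are encoded by their fans.  A fan is a set of cones
in `N ⊗ ℝ`, where `N` is a lattice; the predicates below express the geometric properties of the
toric variety `X` of the fan through the usual dictionary between toric geometry and fans. -/

section Basic

variable {N : Type*} [AddCommGroup N]

/-- The real vector space `N_ℝ = ℝ ⊗ N` of a lattice `N`. -/
abbrev RealSpace (N : Type*) [AddCommGroup N] : Type _ := ℝ ⊗[ℤ] N

/-- The real extension of a homomorphism of lattices. -/
def realMap {N' : Type*} [AddCommGroup N'] (f : N →ₗ[ℤ] N') :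
    RealSpace N →ₗ[ℝ] RealSpace N' :=
  f.baseChange ℝ

/-- The convex cone `⟨S⟩` in `N_ℝ` generated by a set `S` of lattice points. -/
def cone (S : Set N) : PointedCone ℝ (RealSpace N) :=
  PointedCone.hull ℝ ((fun v : N => (1 : ℝ) ⊗ₜ[ℤ] v) '' S)

/-- A fan: a finite nonempty collection of rational, strongly convex polyhedral cones, closed under
passing to faces, and such that two cones always meet in a common face. -/
structure IsFan (Δ : Set (PointedCone ℝ (RealSpace N))) : Prop where
  finite : Δ.Finite
  nonempty : Δ.Nonempty
  rational : ∀ σ ∈ Δ, ∃ S : Finset N, σ = cone (S : Set N)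
  stronglyConvex : ∀ σ ∈ Δ, ∀ x, x ∈ σ → -x ∈ σ → x = 0
  face_mem : ∀ σ ∈ Δ, ∀ τ : PointedCone ℝ (RealSpace N), τ.IsFaceOf σ → τ ∈ Δ
  inter_face : ∀ σ ∈ Δ, ∀ τ ∈ Δ, PointedCone.IsFaceOf (σ ⊓ τ) σ

/-- The toric variety is complete: the cones of the fan cover `N_ℝ`. -/
def IsComplete (Δ : Set (PointedCone ℝ (RealSpace N))) : Prop :=
  ∀ x : RealSpace N, ∃ σ ∈ Δ, x ∈ σ

/-- The toric variety is nonsingular: every cone is generated by a part of a `ℤ`-basis of `N`. -/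
def IsNonsingular (Δ : Set (PointedCone ℝ (RealSpace N))) : Prop :=
  ∀ σ ∈ Δ, ∃ (b : Module.Basis (Fin (Module.finrank ℤ N)) ℤ N)
    (s : Set (Fin (Module.finrank ℤ N))), σ = cone (b '' s)

/-- `ρ` is a ray generator of the fan: the ray `⟨ρ⟩` is a cone of the fan, and the lattice points
of this ray are exactly the multiples `k • ρ`, `k = 0, 1, 2, …`.  Ray generators correspond
bijectively to toric divisors. -/
def IsRayGenerator (Δ : Set (PointedCone ℝ (RealSpace N))) (ρ : N) : Prop :=
  ρ ≠ 0 ∧ cone {ρ} ∈ Δ ∧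
    ∀ v : N, (1 : ℝ) ⊗ₜ[ℤ] v ∈ cone ({ρ} : Set N) → ∃ k : ℕ, v = k • ρ

/-- The toric divisor `∑ a(ρ) D_ρ` (the sum is over the ray generators `ρ`) on the complete
nonsingular toric variety of the fan is ample: the function `ψ` on `N_ℝ` that is linear on every
cone and has `ψ(ρ) = - a(ρ)` for every ray generator `ρ` is strictly convex.  This means that for
every cone `σ` of full dimension, the linear function `u` which agrees with `ψ` on `σ` is strictly
greater than `ψ` outside `σ`. -/
def IsAmple (Δ : Set (PointedCone ℝ (RealSpace N))) (a : N → ℤ) : Prop :=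
  ∃ ψ : RealSpace N → ℝ,
    (∀ σ ∈ Δ, ∃ u : Module.Dual ℝ (RealSpace N), ∀ x ∈ σ, ψ x = u x) ∧
    (∀ ρ : N, IsRayGenerator Δ ρ → ψ ((1 : ℝ) ⊗ₜ[ℤ] ρ) = -(a ρ : ℝ)) ∧
    (∀ σ ∈ Δ, Submodule.span ℝ (σ : Set (RealSpace N)) = ⊤ →
      ∀ u : Module.Dual ℝ (RealSpace N), (∀ x ∈ σ, ψ x = u x) → ∀ x, x ∉ σ → ψ x < u x)

/-- The complete nonsingular toric variety of the fan is Fano: the anticanonical divisor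
`-K_X = ∑ D_ρ`, the sum of all toric divisors, is ample. -/
def IsFano (Δ : Set (PointedCone ℝ (RealSpace N))) : Prop :=
  IsAmple Δ (fun _ => 1)

/-- The sublattice of `N` generated by the lattice points of a cone `σ`. -/
def coneLattice (σ : PointedCone ℝ (RealSpace N)) : Submodule ℤ N :=
  Submodule.span ℤ {v : N | (1 : ℝ) ⊗ₜ[ℤ] v ∈ σ}

/-- The star `Δ(σ)`, the fan of the toric subvariety `X(σ)`: it consists of the images in
`(N / ⟨σ⟩)_ℝ` of the cones of `Δ` that contain `σ`. -/
def star (Δ : Set (PointedCone ℝ (RealSpace N))) (σ : PointedCone ℝ (RealSpace N)) :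
    Set (PointedCone ℝ (RealSpace (N ⧸ coneLattice σ))) :=
  {c | ∃ τ ∈ Δ, σ ≤ τ ∧ c = τ.map (realMap (coneLattice σ).mkQ)}

/-- The star subdivision of the nonsingular fan `Δ` along its cone `σ = ⟨S⟩`: the cones that do
not contain `σ` are kept, and every cone `μ` that contains `σ` is replaced by the cones spanned by
`∑ S` and a face of `μ` that does not contain `σ`. -/
def starSubdivision (Δ : Set (PointedCone ℝ (RealSpace N))) (S : Finset N) :
    Set (PointedCone ℝ (RealSpace N)) :=
  {τ | τ ∈ Δ ∧ ¬ cone (S : Set N) ≤ τ} ∪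
  {c | ∃ μ ∈ Δ, cone (S : Set N) ≤ μ ∧ ∃ τ : PointedCone ℝ (RealSpace N),
    τ.IsFaceOf μ ∧ ¬ cone (S : Set N) ≤ τ ∧ c = τ ⊔ cone {∑ v ∈ S, v}}

/-- `X → X'` is the blow-up of the nonsingular toric variety `X'` along the irreducible toric
subvariety `X'(σ)`, of codimension at least two, for a cone `σ = ⟨ρ₁, …, ρ_k⟩` of `Δ'`, and
`ρ = ρ₁ + ⋯ + ρ_k` is the ray generator of the exceptional divisor.  Equivalently, `X → X'` is the
blow-down of the toric divisor of `X` with ray generator `ρ`. -/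
def IsBlowUp (Δ Δ' : Set (PointedCone ℝ (RealSpace N))) (ρ : N) : Prop :=
  ∃ S : Finset N, 2 ≤ S.card ∧ (∀ v ∈ S, IsRayGenerator Δ' v) ∧ cone (S : Set N) ∈ Δ' ∧
    ρ = ∑ v ∈ S, v ∧ Δ = starSubdivision Δ' S

/-- A set of toric divisors, given by their ray generators, is a primitive set: the ray generators
do not span a cone of the fan, but they do after the removal of any one of them. -/
def IsPrimitiveSet (Δ : Set (PointedCone ℝ (RealSpace N))) (S : Finset N) : Prop :=
  (∀ ρ ∈ S, IsRayGenerator Δ ρ) ∧ cone (S : Set N) ∉ Δ ∧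
    ∀ ρ ∈ S, cone ((S : Set N) \ {ρ}) ∈ Δ

/-- `X` is Fano, every toric subvariety of `X` is Fano, and every nonsingular toric variety `X'`
such that `X → X'` is the blow-down of a toric divisor is Fano. -/
def FanoWithSubvarietiesAndBlowDowns (Δ : Set (PointedCone ℝ (RealSpace N))) : Prop :=
  IsFano Δ ∧ (∀ σ ∈ Δ, IsFano (star Δ σ)) ∧
    ∀ Δ' : Set (PointedCone ℝ (RealSpace N)), IsFan Δ' → IsNonsingular Δ' →
      (∃ ρ : N, IsBlowUp Δ Δ' ρ) → IsFano Δ'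

/-- The ray generators of every primitive set sum to zero or to a ray generator, and every ray
generator is the sum of at most one primitive set. -/
def HasSimplePrimitiveRelations (Δ : Set (PointedCone ℝ (RealSpace N))) : Prop :=
  (∀ S : Finset N, IsPrimitiveSet Δ S →
    ∑ v ∈ S, v = 0 ∨ ∃ ρ' : N, IsRayGenerator Δ ρ' ∧ ∑ v ∈ S, v = ρ') ∧
  ∀ ρ' : N, IsRayGenerator Δ ρ' → ∀ S T : Finset N, IsPrimitiveSet Δ S → IsPrimitiveSet Δ T →
    ∑ v ∈ S, v = ρ' → ∑ v ∈ T, v = ρ' → S = T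

end Basic

section ProjectiveSpaces

/-- The ray generators `e₁, …, e_d` and `e₀ = -(e₁ + ⋯ + e_d)` of the fan of `ℙ^d`. -/
def projectiveRay (d : ℕ) : Fin (d + 1) → (Fin d → ℤ) :=
  Fin.cons (-∑ i : Fin d, Pi.single i 1) (fun i => Pi.single i 1)

/-- The fan of `ℙ^d`: the cones generated by the proper subsets of `{e₀, e₁, …, e_d}`. -/
def projectiveFan (d : ℕ) : Set (PointedCone ℝ (RealSpace (Fin d → ℤ))) :=
  {c | ∃ J : Set (Fin (d + 1)), J ≠ Set.univ ∧ c = cone (projectiveRay d '' J)}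

/-- The fan of the product of the toric varieties of finitely many fans: its cones are the products
of cones of the factors. -/
def productFan {s : ℕ} {N : Fin s → Type*} [∀ i, AddCommGroup (N i)]
    (Δ : ∀ i, Set (PointedCone ℝ (RealSpace (N i)))) :
    Set (PointedCone ℝ (RealSpace (∀ i, N i))) :=
  {c | ∃ σ : ∀ i, PointedCone ℝ (RealSpace (N i)), (∀ i, σ i ∈ Δ i) ∧
    c = ⨆ i, (σ i).map (realMap (LinearMap.single ℤ N i))}

/-- The toric variety of the fan is isomorphic to a product of projective spaces: some isomorphism
of lattices carries the fan to the fan of `ℙ^{d₁} × ⋯ × ℙ^{d_s}`. -/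
def IsProductOfProjectiveSpaces {N : Type*} [AddCommGroup N]
    (Δ : Set (PointedCone ℝ (RealSpace N))) : Prop :=
  ∃ (s : ℕ) (d : Fin s → ℕ) (e : N ≃ₗ[ℤ] (∀ i, Fin (d i) → ℤ)),
    (fun σ : PointedCone ℝ (RealSpace N) => σ.map (realMap e.toLinearMap)) '' Δ =
      productFan (fun i => projectiveFan (d i))

end ProjectiveSpaces

end ToricFan

end

/-!
The proof replaces the fan by the simplicial complex `K` of the sets of ray generators of its cones.
For complete nonsingular fans, `K` is characterised by a condition on lattice points only
(`IsLatticeFan`): every lattice point is in exactly one way a combination, with natural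
coefficients, of the elements of a member of `K`. Conversely, every such complex spans a complete
nonsingular fan of real cones (`fanOf`, `exists_isLatticeFan`). The facts about lattice points that
stand in for convex geometry, above all completeness of the stars, follow from Dickson's lemma
(`IsLatticeFan.exists_add_sum`); a rounding argument transfers uniqueness and completeness to real
points. Ampleness of the anticanonical divisor of the subvariety of a cone `T` becomes an inequality
for the linear form that is `0` on `T` and `1` on the rest of a facet around `T` (`IsStarFano`).

That the variety and all toric subvarieties are Fano means that every primitive set sums to zero or
to a ray generator. For one direction (`hasShortRelations`), let the sum of the primitive set `P`
lie in the cone of a facet `M` and apply the forms for `P ∩ M` or for a subset of it to the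
relation. For the other (`isStarFano`), primitive relations rewrite a ray generator outside `M` in
terms of one with a larger value of the form that is `1` on `M`.

Under this condition, a ray generator that is the sum of a primitive set `P` can always be
contracted: every facet around it contains all but one element of `P`, and wall crossing exchanges
the missing one (`union_erase_mem`, `isSubdivision_contraction`). If `∑ P = ∑ Q` for two primitive
sets, then after the contraction along `P` the set `P` is a cone and `Q` is still primitive, so
that `|P| < |Q|` if the blow-down is Fano; by symmetry this is absurd, so a ray generator is the
sum of at most one primitive set. Conversely, a primitive set of a blow-down comes from a primitive
set of the original fan with the same sum (`IsSubdivision.exists_primitive`), so the conditions on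
primitive relations pass to all blow-downs, and these are Fano.

Contracting as long as possible leads to a fan all of whose primitive sets sum to zero. These sets
are disjoint and contain all ray generators, so the fan is that of a product of projective spaces
(`isProductOfProjectiveSpaces`). Two successive contractions can be exchanged
(`IsSubdivision.exists_swap`); the two results agree because a Fano fan is determined by its ray
generators. Hence every order of the contractions is possible.
-/

namespace ToricFan

open scoped Classical

section Combinatorial

/-! ### Complete nonsingular fans as simplicial complexes of lattice points -/

variable {N : Type*}

/-- A primitive set of the complex: a set of vertices that is a minimal nonmember. -/
def IsPrimitive (K : Set (Finset N)) (P : Finset N) : Prop :=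
  (∀ v ∈ P, {v} ∈ K) ∧ P ∉ K ∧ ∀ v ∈ P, P.erase v ∈ K

/-- A facet: a maximal member of the complex, that is, a cone of full dimension. -/
def IsFacet (K : Set (Finset N)) (M : Finset N) : Prop :=
  M ∈ K ∧ ∀ A ∈ K, M ⊆ A → A = M

lemma IsPrimitive.mem_of_ssubset {K : Set (Finset N)} (hd : ∀ S ∈ K, ∀ T, T ⊆ S → T ∈ K)
    {P A : Finset N} (hP : IsPrimitive K P) (hA : A ⊆ P) (hne : ¬ P ⊆ A) : A ∈ K := by
  obtain ⟨x, hx, hxA⟩ := Finset.not_subset.1 hne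
  exact hd _ (hP.2.2 x hx) _ fun a ha => Finset.mem_erase.2 ⟨fun h => hxA (h ▸ ha), hA ha⟩

/-- Primitive sets detect the complex: a set of vertices outside `K` contains one. -/
lemma exists_primitive {K : Set (Finset N)} {A : Finset N} (hA : ∀ v ∈ A, {v} ∈ K) (h : A ∉ K) :
    ∃ P ⊆ A, IsPrimitive K P := by
  induction A using Finset.strongInduction with
  | H A ih =>
    by_cases h' : ∀ v ∈ A, A.erase v ∈ K
    · exact ⟨A, subset_rfl, hA, h, h'⟩
    · push Not at h'
      obtain ⟨v, hv, hvA⟩ := h'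
      obtain ⟨P, hP, hP'⟩ := ih _ (Finset.erase_ssubset hv)
        (fun w hw => hA w (Finset.mem_of_mem_erase hw)) hvA
      exact ⟨P, hP.trans (Finset.erase_subset _ _), hP'⟩

/-- The sum of the elements of `P`, as a formal combination. -/
noncomputable def indicator (P : Finset N) : N →₀ ℕ := ∑ v ∈ P, Finsupp.single v 1

lemma indicator_apply (P : Finset N) (v : N) : indicator P v = if v ∈ P then 1 else 0 := by
  simp [indicator, Finsupp.finsetSum_apply, Finsupp.single_apply]

@[simp] lemma support_indicator (P : Finset N) : (indicator P).support = P := by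
  ext v; simp [indicator_apply]

variable [AddCommGroup N]

/-- The lattice point `∑ f(v) v` attached to a formal combination `f` of lattice points with
natural coefficients. -/
noncomputable abbrev latticeSum : (N →₀ ℕ) →ₗ[ℕ] N := Finsupp.linearCombination ℕ id

/-- A complete nonsingular fan in combinatorial form: a finite simplicial complex `K` of finite
sets of lattice points (the sets of ray generators of the cones) such that every lattice point is,
in exactly one way, a combination with natural coefficients of the elements of a member of `K`.
No real cones occur here. -/
structure IsLatticeFan (K : Set (Finset N)) : Prop where
  finite : K.Finite
  down : ∀ S ∈ K, ∀ T, T ⊆ S → T ∈ K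
  inj : ∀ f g : N →₀ ℕ, f.support ∈ K → g.support ∈ K → latticeSum f = latticeSum g → f = g
  surj : ∀ x : N, ∃ f : N →₀ ℕ, f.support ∈ K ∧ latticeSum f = x

@[simp] lemma latticeSum_indicator (P : Finset N) : latticeSum (indicator P) = ∑ v ∈ P, v := by
  simp [indicator, map_sum]

namespace IsLatticeFan

variable {K : Set (Finset N)} (hK : IsLatticeFan K)
include hK

lemma empty_mem : ∅ ∈ K := by
  obtain ⟨f, hf, -⟩ := hK.surj 0
  exact hK.down _ hf _ (Finset.empty_subset _)

lemma singleton_mem {S : Finset N} (hS : S ∈ K) {v : N} (hv : v ∈ S) : {v} ∈ K :=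
  hK.down _ hS _ (by simpa using hv)

lemma eq_of_sum_eq {A B : Finset N} (hA : A ∈ K) (hB : B ∈ K) (h : ∑ v ∈ A, v = ∑ v ∈ B, v) :
    A = B := by
  have := hK.inj (indicator A) (indicator B) (by simpa) (by simpa) (by simpa using h)
  rw [← support_indicator A, this, support_indicator]

lemma eq_empty_of_sum_eq_zero {A : Finset N} (hA : A ∈ K) (h : ∑ v ∈ A, v = 0) : A = ∅ :=
  hK.eq_of_sum_eq hA hK.empty_mem (by simpa using h)

lemma ne_zero {v : N} (hv : {v} ∈ K) : v ≠ 0 := fun h => by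
  have := hK.eq_empty_of_sum_eq_zero hv (by simpa using h)
  simp at this

lemma exists_facet {S : Finset N} (hS : S ∈ K) : ∃ M, IsFacet K M ∧ S ⊆ M := by
  obtain ⟨M, hSM, hM⟩ := hK.finite.exists_le_maximal hS
  exact ⟨M, ⟨hM.1, fun A hA h => (hM.2 hA h).antisymm h⟩, hSM⟩

lemma two_le_card {P : Finset N} (hP : IsPrimitive K P) : 2 ≤ P.card := by
  by_contra h
  have h1 : P.card ≤ 1 := by omega
  rcases Finset.card_le_one_iff_subset_singleton.1 h1 with ⟨x, hx⟩
  rcases Finset.subset_singleton_iff.1 hx with rfl | rfl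
  · exact hP.2.1 hK.empty_mem
  · exact hP.2.1 (hP.1 x (by simp))

lemma exists_vertices : ∃ W : Finset N, ∀ v, v ∈ W ↔ {v} ∈ K := by
  have : {v : N | {v} ∈ K}.Finite :=
    hK.finite.preimage (f := fun v : N => ({v} : Finset N)) (by simp [Set.InjOn])
  exact ⟨this.toFinset, by simp⟩

/-- Dickson's lemma for combinations that are supported on the complex. -/
lemma exists_lt_le (F : ℕ → N →₀ ℕ) (hF : ∀ n, (F n).support ∈ K) :
    ∃ m n, m < n ∧ F m ≤ F n := by
  obtain ⟨W, hW⟩ := hK.exists_vertices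
  obtain ⟨m, n, hmn, h⟩ := wellQuasiOrdered_le (α := W → ℕ) (fun n w => F n w)
  refine ⟨m, n, hmn, fun v => ?_⟩
  by_cases hv : v ∈ (F m).support
  · exact h ⟨v, (hW v).2 (hK.singleton_mem (hF m) hv)⟩
  · simp [Finsupp.notMem_support_iff.1 hv]

/-- Completeness of the star of `S`: every lattice point becomes, after adding a multiple of the
interior point `∑ S` of the cone of `S`, a point of a cone that contains `S`. -/
lemma exists_add_sum {S : Finset N} (hS : S ∈ K) (x : N) :
    ∃ (n : ℕ) (f : N →₀ ℕ), f.support ∪ S ∈ K ∧ latticeSum f = n • (∑ v ∈ S, v) + x := by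
  choose F hF hFx using fun n : ℕ => hK.surj (n • (∑ v ∈ S, v) + x)
  obtain ⟨m, n, hmn, hle⟩ := hK.exists_lt_le F hF
  have hsub : (F n - F m).support ∈ K :=
    hK.down _ (hF n) _ fun v hv => by
      simp only [Finsupp.mem_support_iff, Finsupp.tsub_apply] at hv ⊢
      omega
  have heq : F n - F m = (n - m) • indicator S := by
    have hs : ((n - m) • indicator S).support = S := by
      ext v
      simp only [Finsupp.mem_support_iff, Finsupp.smul_apply, indicator_apply]
      split_ifs <;> (simp_all; try omega)
    refine hK.inj _ _ hsub (by rwa [hs]) ?_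
    have h1 : latticeSum (F n - F m) + latticeSum (F m) = latticeSum (F n) := by
      rw [← map_add, tsub_add_cancel_of_le hle]
    rw [map_nsmul, latticeSum_indicator]
    rw [hFx, hFx] at h1
    have h2 : n • (∑ v ∈ S, v) = (n - m) • (∑ v ∈ S, v) + m • (∑ v ∈ S, v) := by
      rw [← add_smul]; congr 1; omega
    rw [h2, ← add_assoc] at h1
    exact add_right_cancel (add_right_cancel h1)
  refine ⟨n, F n, ?_, hFx n⟩
  have : S ⊆ (F n).support := fun v hv => by
    have := DFunLike.congr_fun heq v
    simp [indicator_apply, hv] at this ⊢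
    omega
  rw [Finset.union_eq_left.2 this]
  exact hF n

/-- The elements of a member of the complex are linearly independent. -/
lemma linearIndependent {S : Finset N} (hS : S ∈ K) :
    LinearIndependent ℤ (fun v : S => (v : N)) := by
  rw [Fintype.linearIndependent_iff]
  intro g hg v
  let f₁ : N →₀ ℕ := ∑ w : S, Finsupp.single (w : N) (g w).toNat
  let f₂ : N →₀ ℕ := ∑ w : S, Finsupp.single (w : N) (-g w).toNat
  have key : ∀ c : S → ℕ, (∑ w : S, Finsupp.single (w : N) (c w)).support ∈ K := fun c =>
    hK.down _ hS _ fun x hx => by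
      by_contra hxS
      refine (Finsupp.mem_support_iff.1 hx) ?_
      rw [Finsupp.finsetSum_apply]
      refine Finset.sum_eq_zero fun w _ => Finsupp.single_eq_of_ne ?_
      rintro rfl
      exact hxS w.2
  have hval : ∀ (c : S → ℕ) (w : S), (∑ w : S, Finsupp.single (w : N) (c w)) (w : N) = c w := by
    intro c w
    rw [Finsupp.finsetSum_apply, Finset.sum_eq_single w]
    · simp
    · intro b _ hb
      exact Finsupp.single_eq_of_ne (fun h => hb (Subtype.ext h.symm))
    · simp
  have h := hK.inj f₁ f₂ (key _) (key _) (by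
    simp only [f₁, f₂, map_sum, Finsupp.linearCombination_single, id]
    rw [← sub_eq_zero, ← Finset.sum_sub_distrib, ← hg]
    refine Finset.sum_congr rfl fun w _ => ?_
    rw [← natCast_zsmul, ← natCast_zsmul, ← sub_smul]
    congr 1; omega)
  have := DFunLike.congr_fun h (v : N)
  simp only [f₁, f₂, hval] at this
  omega

lemma span_facet {M : Finset N} (hM : IsFacet K M) :
    ⊤ ≤ Submodule.span ℤ (Set.range (fun v : M => (v : N))) := by
  intro x _
  obtain ⟨n, f, hf, hfx⟩ := hK.exists_add_sum hM.1 x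
  have hfM : f.support ⊆ M := by
    rw [← hM.2 _ hf Finset.subset_union_right]; exact Finset.subset_union_left
  have hmem : ∀ v ∈ M, v ∈ Submodule.span ℤ (Set.range (fun v : M => (v : N))) := fun v hv =>
    Submodule.subset_span ⟨⟨v, hv⟩, rfl⟩
  have : x = latticeSum f - n • (∑ v ∈ M, v) := by rw [hfx]; abel
  rw [this]
  refine Submodule.sub_mem _ ?_ (Submodule.smul_of_tower_mem _ _ (Submodule.sum_mem _ hmem))
  rw [Finsupp.linearCombination_apply, Finsupp.sum]
  exact Submodule.sum_mem _ fun v hv => Submodule.smul_of_tower_mem _ _ (hmem v (hfM hv))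

/-- The elements of a facet form a basis of the lattice. -/
noncomputable def basis {M : Finset N} (hM : IsFacet K M) : Module.Basis M ℤ N :=
  Module.Basis.mk (hK.linearIndependent hM.1) (hK.span_facet hM)

@[simp] lemma basis_apply {M : Finset N} (hM : IsFacet K M) (v : M) :
    hK.basis hM v = v := by simp [basis]

/-- A linear form on the lattice may be prescribed on a facet. -/
lemma exists_dual {M : Finset N} (hM : IsFacet K M) (c : N → ℤ) :
    ∃ ℓ : N →ₗ[ℤ] ℤ, ∀ v ∈ M, ℓ v = c v := by
  refine ⟨(hK.basis hM).constr ℤ fun v => c v, fun v hv => ?_⟩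
  have := (hK.basis hM).constr_basis ℤ (fun v : M => c v) ⟨v, hv⟩
  simpa using this

/-- Wall crossing: removing one element from a facet, the remaining wall lies in a
second facet. -/
lemma exists_adjacent {M : Finset N} (hM : IsFacet K M) {p : N} (hp : p ∈ M) :
    ∃ q, q ∉ M ∧ insert q (M.erase p) ∈ K := by
  obtain ⟨n, f, hf, hfx⟩ := hK.exists_add_sum (hK.down _ hM.1 _ (M.erase_subset p)) (-p)
  have : ∃ q ∈ f.support, q ∉ M := by
    by_contra! hcon
    -- otherwise `f + p` and a multiple of the wall are equal combinations supported on `M`, but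
    -- only the first one involves `p`
    have h := hK.inj (f + Finsupp.single p 1) (n • indicator (M.erase p))
      (hK.down _ hM.1 _ fun v hv => by
        rcases Finset.mem_union.1 (Finsupp.support_add hv) with h | h
        · exact hcon v h
        · have := Finsupp.support_single_subset h
          rw [Finset.mem_singleton] at this; exact this ▸ hp)
      (hK.down _ hM.1 _ fun v hv => by
        simp [indicator_apply] at hv; exact hv.2.1)
      (by rw [map_add, hfx, map_nsmul, latticeSum_indicator]; simp)
    have := DFunLike.congr_fun h p
    simp [indicator_apply] at this
  obtain ⟨q, hq, hqM⟩ := this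
  refine ⟨q, hqM, hK.down _ hf _ ?_⟩
  exact Finset.insert_subset (Finset.mem_union_left _ hq) Finset.subset_union_right

end IsLatticeFan

lemma latticeSum_apply (f : N →₀ ℕ) (ℓ : N →ₗ[ℤ] ℤ) :
    ℓ (latticeSum f) = ∑ v ∈ f.support, (f v : ℤ) * ℓ v := by
  rw [Finsupp.linearCombination_apply, Finsupp.sum, map_sum]
  simp

/-! ### Primitive relations and ampleness of the anticanonical divisor -/

/-- The anticanonical divisor of the subvariety of the cone of `T` is ample: for every facet `M`
that contains `T`, the linear form that is `0` on `T` and `1` on the remaining elements of `M` is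
at most `0` on the vertices of the link of `T` outside `M`. Nothing in the quotient by the span of
`T` is mentioned: a linear form on the quotient is a form that vanishes on `T`. For `T = ∅` this is
the Fano property of the whole variety. -/
def IsStarFano (K : Set (Finset N)) (T : Finset N) : Prop :=
  ∀ M, IsFacet K M → T ⊆ M → ∀ ℓ : N →ₗ[ℤ] ℤ, (∀ v ∈ T, ℓ v = 0) → (∀ v ∈ M, v ∉ T → ℓ v = 1) →
    ∀ w, insert w T ∈ K → w ∉ M → ℓ w ≤ 0

/-- Every primitive set sums to zero or to a vertex. -/
def HasShortRelations (K : Set (Finset N)) : Prop :=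
  ∀ P, IsPrimitive K P → ∑ v ∈ P, v = 0 ∨ {∑ v ∈ P, v} ∈ K

/-- Different primitive sets never have the same vertex as their sum. -/
def HasDistinctSums (K : Set (Finset N)) : Prop :=
  ∀ P Q, IsPrimitive K P → IsPrimitive K Q → {∑ v ∈ P, v} ∈ K → ∑ v ∈ P, v = ∑ v ∈ Q, v → P = Q

namespace IsLatticeFan

variable {K : Set (Finset N)} (hK : IsLatticeFan K)
include hK

/-- The expression of the sum of a primitive set `P` in its cone involves no element of `P`. -/
lemma apply_eq_zero {P : Finset N} (hP : IsPrimitive K P) {f : N →₀ ℕ}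
    (hf : f.support ∈ K) (h : latticeSum f = ∑ v ∈ P, v) {x : N} (hx : x ∈ P) : f x = 0 := by
  by_contra hfx
  have hle : Finsupp.single x 1 ≤ f := by
    rw [Finsupp.single_le_iff]; omega
  have h1 := hK.inj (f - Finsupp.single x 1) (indicator (P.erase x))
    (hK.down _ hf _ fun v hv => by
      simp only [Finsupp.mem_support_iff, Finsupp.tsub_apply] at hv ⊢; omega)
    (by simpa using hP.2.2 x hx) (by
      have h2 : latticeSum (f - Finsupp.single x 1) + latticeSum (Finsupp.single x 1)
          = latticeSum f := by rw [← map_add, tsub_add_cancel_of_le hle]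
      rw [latticeSum_indicator, ← add_right_cancel_iff (a := x), Finset.sum_erase_add _ _ hx, ← h,
        ← h2]
      simp)
  refine hP.2.1 (hK.down _ hf _ fun v hv => ?_)
  by_cases hvx : v = x
  · subst hvx; simpa using hfx
  · have := DFunLike.congr_fun h1 v
    simp [indicator_apply, hvx, hv] at this
    simp; omega

/-- If the anticanonical divisors of all toric subvarieties are ample, then every primitive set
sums to zero or to a vertex. The sum of `P` lies in the cone of a facet `M`. If at least two
elements of `P` are outside `M`, ampleness for `P ∩ M` shows that the sum is zero; if only one is,
ampleness for `P ∩ M` without one of its elements bounds the coefficients. -/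
theorem hasShortRelations (h : ∀ T ∈ K, IsStarFano K T) : HasShortRelations K := by
  intro P hP
  obtain ⟨f, hf, hfP⟩ := hK.surj (∑ v ∈ P, v)
  have hf0 : ∀ x ∈ P, f x = 0 := fun x hx => hK.apply_eq_zero hP hf hfP hx
  obtain ⟨M, hM, hfM⟩ := hK.exists_facet hf
  -- a set `T ⊂ P ∩ M` and its form `ℓ` turn the relation into `∑ f = ∑_{P \ T} ℓ`
  have key : ∀ T ⊆ P ∩ M, ∃ ℓ : N →ₗ[ℤ] ℤ, (∀ v ∈ T, ℓ v = 0) ∧ (∀ v ∈ M, v ∉ T → ℓ v = 1) ∧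
      (f.degree : ℤ) = ∑ v ∈ P \ T, ℓ v := by
    intro T hT
    obtain ⟨ℓ, hℓ⟩ := hK.exists_dual hM fun v => if v ∈ T then 0 else 1
    have hT0 : ∀ v ∈ T, ℓ v = 0 := fun v hv => by
      rw [hℓ v (Finset.mem_inter.1 (hT hv)).2, if_pos hv]
    refine ⟨ℓ, hT0, fun v hv hvT => by rw [hℓ v hv, if_neg hvT], ?_⟩
    have h1 : ℓ (latticeSum f) = f.degree := by
      rw [latticeSum_apply, Finsupp.degree_apply, Nat.cast_sum]
      refine Finset.sum_congr rfl fun v hv => ?_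
      rw [hℓ v (hfM hv), if_neg, mul_one]
      intro hvT
      exact (Finsupp.mem_support_iff.1 hv) (hf0 v (Finset.mem_inter.1 (hT hvT)).1)
    rw [← h1, hfP, map_sum, ← Finset.sum_sdiff (hT.trans Finset.inter_subset_left),
      Finset.sum_eq_zero hT0, add_zero]
  have hdeg : f.degree ≤ 1 := by
    by_cases h2 : ∃ x, P \ M = {x}
    · obtain ⟨x, hx⟩ := h2
      have hxP : x ∈ P ∧ x ∉ M := by
        rw [← Finset.mem_sdiff, hx]; exact Finset.mem_singleton_self x
      obtain ⟨y, hy⟩ : (P ∩ M).Nonempty := by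
        rw [Finset.nonempty_iff_ne_empty]; intro h0
        have h3 := Finset.card_sdiff_add_card_inter P M
        have h4 := hK.two_le_card hP
        rw [hx, h0] at h3; simp at h3; omega
      have hyP := Finset.mem_inter.1 hy
      obtain ⟨ℓ, h0, h1, hs⟩ := key ((P ∩ M).erase y) (Finset.erase_subset _ _)
      have hPT : P \ (P ∩ M).erase y = {x, y} := by
        ext v
        have hv := Finset.ext_iff.1 hx v
        simp only [Finset.mem_sdiff, Finset.mem_singleton] at hv
        simp only [Finset.mem_sdiff, Finset.mem_erase, Finset.mem_inter, Finset.mem_insert,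
          Finset.mem_singleton]
        constructor
        · rintro ⟨a, b⟩
          by_cases hvy : v = y
          · exact Or.inr hvy
          · exact Or.inl (hv.1 ⟨a, fun hvM => b ⟨hvy, a, hvM⟩⟩)
        · rintro (rfl | rfl)
          · exact ⟨hxP.1, fun b => hxP.2 b.2.2⟩
          · exact ⟨hyP.1, fun b => b.1 rfl⟩
      have hxy : x ≠ y := fun h => hxP.2 (h ▸ hyP.2)
      have hins : insert x ((P ∩ M).erase y) ∈ K := hK.down _ (hP.2.2 y hyP.1) _ fun v hv => by
        simp only [Finset.mem_insert, Finset.mem_erase, Finset.mem_inter] at hv ⊢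
        rcases hv with rfl | hv
        · exact ⟨hxy, hxP.1⟩
        · exact ⟨hv.1, hv.2.1⟩
      have := h _ (hK.down _ hins _ (Finset.subset_insert _ _)) M hM
        ((Finset.erase_subset _ _).trans Finset.inter_subset_right) ℓ h0 h1 x hins hxP.2
      rw [hPT, Finset.sum_pair hxy, h1 y hyP.2 (by simp)] at hs
      omega
    · obtain ⟨ℓ, h0, h1, hs⟩ := key (P ∩ M) subset_rfl
      rw [Finset.sdiff_inter_self_left] at hs
      have : ∑ v ∈ P \ M, ℓ v ≤ 0 := Finset.sum_nonpos fun x hx => by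
        have hxP := Finset.mem_sdiff.1 hx
        have hins : insert x (P ∩ M) ∈ K := by
          refine hP.mem_of_ssubset hK.down
            (Finset.insert_subset hxP.1 Finset.inter_subset_left) fun hsub => h2 ⟨x, ?_⟩
          refine (Finset.eq_singleton_iff_unique_mem).2 ⟨hx, fun y hy => ?_⟩
          have hy' := Finset.mem_sdiff.1 hy
          rcases Finset.mem_insert.1 (hsub hy'.1) with h | h
          · exact h
          · exact absurd (Finset.mem_inter.1 h).2 hy'.2
        exact h _ (hK.down _ hins _ (Finset.subset_insert _ _)) M hM Finset.inter_subset_right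
          ℓ h0 h1 x hins hxP.2
      omega
  rcases Nat.le_one_iff_eq_zero_or_eq_one.1 hdeg with h0 | h1
  · left
    rw [Finsupp.degree_eq_zero_iff] at h0
    rw [← hfP, h0, map_zero]
  · right
    obtain ⟨v, hv⟩ : ∃ v, f = Finsupp.single v 1 := by
      rw [Finsupp.degree_apply] at h1
      obtain ⟨v, hv⟩ : f.support.Nonempty := by
        rw [Finset.nonempty_iff_ne_empty]; intro h0; simp [h0] at h1
      rw [← Finset.add_sum_erase _ _ hv] at h1
      have hv0 := Finsupp.mem_support_iff.1 hv
      refine ⟨v, Finsupp.ext fun w => ?_⟩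
      by_cases hw : w = v
      · subst hw; simp; omega
      · rw [Finsupp.single_eq_of_ne hw]
        by_contra hw0
        have := Finset.single_le_sum (f := fun x => f x) (fun _ _ => Nat.zero_le _)
          (Finset.mem_erase.2 ⟨hw, Finsupp.mem_support_iff.2 hw0⟩)
        omega
    rw [← hfP, hv]
    rw [hv] at hf
    simpa [Finsupp.support_single] using hf

/-- If every primitive set sums to zero or to a vertex, then the anticanonical divisors of all
toric subvarieties are ample. A vertex `w` outside `M` belongs to a primitive set that is otherwise
contained in `M`, and its relation replaces `w` by a vertex with a larger value of the linear form
that is `1` on all of `M`. So the form `ℓ` of `T` is at most `1` on all vertices. -/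
theorem isStarFano (h : HasShortRelations K) (T : Finset N) : IsStarFano K T := by
  intro M hM hTM ℓ h0 h1
  obtain ⟨φ, hφ⟩ := hK.exists_dual hM fun _ => 1
  have hnn : ∀ v ∈ M, 0 ≤ ℓ v := fun v hv => by
    by_cases hvT : v ∈ T
    · rw [h0 v hvT]
    · rw [h1 v hv hvT]; exact zero_le_one
  have step : ∀ w, {w} ∈ K → w ∉ M → ∃ P, IsPrimitive K P ∧ w ∈ P ∧ P.erase w ⊆ M := by
    intro w hw hwM
    obtain ⟨P, hP, hprim⟩ := exists_primitive (K := K) (A := insert w M)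
      (fun v hv => by
        rcases Finset.mem_insert.1 hv with rfl | hv
        · exact hw
        · exact hK.singleton_mem hM.1 hv)
      (fun hcon => hwM (by
        have := hM.2 _ hcon (Finset.subset_insert _ _)
        rw [← this]; exact Finset.mem_insert_self _ _))
    have hsub : P.erase w ⊆ M := fun v hv => by
      have hv' := Finset.mem_erase.1 hv
      exact (Finset.mem_insert.1 (hP hv'.2)).resolve_left hv'.1
    refine ⟨P, hprim, ?_, hsub⟩
    by_contra hwP
    rw [Finset.erase_eq_of_notMem hwP] at hsub
    exact hprim.2.1 (hK.down _ hM.1 _ hsub)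
  have bound : ∀ w, {w} ∈ K → ℓ w ≤ 1 := by
    by_contra! hcon
    obtain ⟨w₁, hw₁, hb₁⟩ := hcon
    obtain ⟨W, hW⟩ := hK.exists_vertices
    obtain ⟨w, hw, hmax⟩ := Finset.exists_max_image (W.filter fun w => 1 < ℓ w) φ
      ⟨w₁, Finset.mem_filter.2 ⟨(hW _).2 hw₁, hb₁⟩⟩
    rw [Finset.mem_filter, hW] at hw
    have hwM : w ∉ M := fun hwM => by
      by_cases hwT : w ∈ T
      · have := h0 w hwT; omega
      · have := h1 w hwM hwT; omega
    obtain ⟨P, hP, hwP, hsub⟩ := step w hw.1 hwM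
    have hPc := hK.two_le_card hP
    have hℓ : ℓ w + ∑ v ∈ P.erase w, ℓ v = ℓ (∑ v ∈ P, v) := by
      rw [map_sum, Finset.add_sum_erase _ _ hwP]
    have hφ' : φ w + (P.erase w).card = φ (∑ v ∈ P, v) := by
      rw [map_sum, ← Finset.add_sum_erase _ _ hwP,
        Finset.sum_congr rfl fun v hv => hφ v (hsub hv)]
      simp
    rw [Finset.card_erase_of_mem hwP] at hφ'
    have hn : 0 ≤ ∑ v ∈ P.erase w, ℓ v := Finset.sum_nonneg fun v hv => hnn v (hsub hv)
    rcases h P hP with hz | hv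
    · rw [hz, map_zero] at hℓ; omega
    · have := hmax _ (Finset.mem_filter.2 ⟨(hW _).2 hv, by omega⟩)
      omega
  intro w hw hwM
  obtain ⟨P, hP, hwP, hsub⟩ := step w (hK.singleton_mem hw (Finset.mem_insert_self _ _)) hwM
  obtain ⟨p, hp, hpT⟩ : ∃ p ∈ P.erase w, p ∉ T := by
    by_contra! hcon
    refine hP.2.1 (hK.down _ hw _ fun v hv => ?_)
    by_cases hvw : v = w
    · exact Finset.mem_insert.2 (Or.inl hvw)
    · exact Finset.mem_insert_of_mem (hcon v (Finset.mem_erase.2 ⟨hvw, hv⟩))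
  have hℓ : ℓ w + ∑ v ∈ P.erase w, ℓ v = ℓ (∑ v ∈ P, v) := by
    rw [map_sum, Finset.add_sum_erase _ _ hwP]
  have hge : ℓ p ≤ ∑ v ∈ P.erase w, ℓ v :=
    Finset.single_le_sum (f := fun v => ℓ v) (fun v hv => hnn v (hsub hv)) hp
  rw [h1 p (hsub hp) hpT] at hge
  have : ℓ (∑ v ∈ P, v) ≤ 1 := by
    rcases h P hP with hz | hv
    · rw [hz, map_zero]; exact zero_le_one
    · exact bound _ hv
  omega

/-- On a Fano variety, a primitive relation lowers the number of summands. -/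
lemma card_lt_card (h : IsStarFano K ∅) {P Q : Finset N} (hP : P ∈ K) (hQ : IsPrimitive K Q)
    (hPQ : ∑ v ∈ P, v = ∑ v ∈ Q, v) : P.card < Q.card := by
  obtain ⟨M, hM, hPM⟩ := hK.exists_facet hP
  obtain ⟨φ, hφ⟩ := hK.exists_dual hM fun _ => 1
  have h1 : ∑ v ∈ P, φ v = ∑ v ∈ Q, φ v := by rw [← map_sum, ← map_sum, hPQ]
  rw [Finset.sum_congr rfl fun v hv => hφ v (hPM hv)] at h1
  have hout : ∀ v ∈ Q, v ∉ M → φ v ≤ 0 := fun v hv hvM =>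
    h M hM (Finset.empty_subset _) φ (by simp) (fun v hv _ => hφ v hv) v (by simpa using hQ.1 v hv)
      hvM
  have h2 : ∑ v ∈ Q, φ v < ∑ v ∈ Q, 1 := by
    refine Finset.sum_lt_sum (fun v hv => ?_) ?_
    · by_cases hvM : v ∈ M
      · rw [hφ v hvM]
      · exact (hout v hv hvM).trans zero_le_one
    · obtain ⟨v, hv, hvM⟩ := Finset.not_subset.1 fun hQM => hQ.2.1 (hK.down _ hM.1 _ hQM)
      exact ⟨v, hv, (hout v hv hvM).trans_lt zero_lt_one⟩
  simp at h1 h2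
  omega

/-- A Fano fan is determined by its vertices, as the complex of faces of their convex hull. -/
lemma eq_of_vertices_eq (h : IsStarFano K ∅) {K' : Set (Finset N)} (hK' : IsLatticeFan K')
    (h' : IsStarFano K' ∅) (hv : ∀ v, {v} ∈ K ↔ {v} ∈ K') : K = K' := by
  -- the degree of the expression of a lattice point in one fan is minimal
  have key : ∀ K₁ K₂ : Set (Finset N), IsLatticeFan K₁ → IsStarFano K₁ ∅ → IsLatticeFan K₂ →
      (∀ v, {v} ∈ K₂ → {v} ∈ K₁) → ∀ f g : N →₀ ℕ, f.support ∈ K₁ → g.support ∈ K₂ →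
      latticeSum f = latticeSum g →
      f.degree ≤ g.degree ∧ (f.degree = g.degree → g.support ∈ K₁) := by
    intro K₁ K₂ h₁ hF h₂ hv f g hf hg hfg
    obtain ⟨M, hM, hfM⟩ := h₁.exists_facet hf
    obtain ⟨φ, hφ⟩ := h₁.exists_dual hM fun _ => 1
    have hout : ∀ v ∈ g.support, v ∉ M → φ v ≤ 0 := fun v hvg hvM =>
      hF M hM (Finset.empty_subset _) φ (by simp) (fun v hv _ => hφ v hv) v
        (by simpa using hv v (h₂.singleton_mem hg hvg)) hvM
    have hd : (f.degree : ℤ) = ∑ v ∈ g.support, (g v : ℤ) * φ v := by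
      rw [← latticeSum_apply, ← hfg, latticeSum_apply, Finsupp.degree_apply, Nat.cast_sum]
      exact Finset.sum_congr rfl fun v hv => by rw [hφ v (hfM hv), mul_one]
    have hd' : (g.degree : ℤ) = ∑ v ∈ g.support, (g v : ℤ) := by
      rw [Finsupp.degree_apply, Nat.cast_sum]
    have hle : ∀ v ∈ g.support, (g v : ℤ) * φ v ≤ g v := fun v hv => by
      by_cases hvM : v ∈ M
      · rw [hφ v hvM, mul_one]
      · have := hout v hv hvM
        nlinarith [Int.natCast_nonneg (g v)]
    refine ⟨by have := Finset.sum_le_sum hle; omega, fun heq => ?_⟩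
    refine h₁.down _ hM.1 _ fun v hv => ?_
    by_contra hvM
    have hlt := Finset.sum_lt_sum hle ⟨v, hv, by
      have := hout v hv hvM
      have := Nat.pos_of_ne_zero (Finsupp.mem_support_iff.1 hv)
      nlinarith⟩
    omega
  have sub : ∀ K₁ K₂ : Set (Finset N), IsLatticeFan K₁ → IsStarFano K₁ ∅ → IsLatticeFan K₂ →
      IsStarFano K₂ ∅ → (∀ v, {v} ∈ K₁ ↔ {v} ∈ K₂) → K₂ ⊆ K₁ := by
    intro K₁ K₂ h₁ hF₁ h₂ hF₂ hv A hA
    obtain ⟨f, hf, hfA⟩ := h₁.surj (∑ v ∈ A, v)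
    have hA' : (indicator A).support ∈ K₂ := by simpa
    rw [← latticeSum_indicator] at hfA
    have a := key K₁ K₂ h₁ hF₁ h₂ (fun v => (hv v).2) f _ hf hA' hfA
    have b := key K₂ K₁ h₂ hF₂ h₁ (fun v => (hv v).1) _ f hA' hf hfA.symm
    simpa using a.2 (le_antisymm a.1 b.1)
  exact (sub K' K hK' h' hK h fun v => (hv v).symm).antisymm (sub K K' hK h hK' h' hv)

/-- The sum of a primitive set is not one of its elements. -/
lemma sum_notMem {P : Finset N} (hP : IsPrimitive K P) : ∑ v ∈ P, v ∉ P := by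
  intro h
  have h1 := Finset.sum_erase_add P (fun v => v) h
  have h2 := hK.eq_empty_of_sum_eq_zero (hP.2.2 _ h) (by simpa using h1)
  have h3 := Finset.card_erase_of_mem h
  have := hK.two_le_card hP
  rw [h2] at h3; simp at h3; omega

/-- If the sum of a primitive set `P` is a vertex `ρ`, then every facet that contains `ρ` contains
all elements of `P` but one, and wall crossing exchanges the missing element. So any
member of the complex that contains `ρ` can be enlarged by any proper subset of `P`: the divisor of
`ρ` can be blown down. -/
lemma union_erase_mem (h : HasShortRelations K) {P A : Finset N} (hP : IsPrimitive K P)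
    (hA : insert (∑ v ∈ P, v) A ∈ K) (hd : Disjoint A P) {p : N} (hp : p ∈ P) :
    insert (∑ v ∈ P, v) (A ∪ P.erase p) ∈ K := by
  set ρ := ∑ v ∈ P, v with hρ
  have hρP : ρ ∉ P := hK.sum_notMem hP
  -- all but at most one element of `P` lie in a facet around `ρ`
  have key : ∀ M, IsFacet K M → ρ ∈ M → ∀ x ∈ P, ∀ y ∈ P, x ∉ M → y ∉ M → x = y := by
    intro M hM hρM x hx y hy hxM hyM
    by_contra hxy
    obtain ⟨ℓ, hℓ⟩ := hK.exists_dual hM fun v => if v ∈ P ∩ M then 0 else 1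
    have hT0 : ∀ v ∈ P ∩ M, ℓ v = 0 := fun v hv => by
      rw [hℓ v (Finset.mem_inter.1 hv).2, if_pos hv]
    have h1 : ℓ ρ = ∑ v ∈ P \ M, ℓ v := by
      rw [hρ, map_sum, ← Finset.sum_sdiff (Finset.inter_subset_left (s₁ := P) (s₂ := M)),
        Finset.sum_eq_zero hT0, add_zero, Finset.sdiff_inter_self_left]
    rw [hℓ ρ hρM, if_neg (fun h => hρP (Finset.mem_inter.1 h).1)] at h1
    have : ∑ v ∈ P \ M, ℓ v ≤ 0 := Finset.sum_nonpos fun v hv => by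
      have hvP := Finset.mem_sdiff.1 hv
      refine hK.isStarFano h (P ∩ M) M hM Finset.inter_subset_right ℓ hT0
        (fun v hv hvn => by rw [hℓ v hv, if_neg hvn]) v ?_ hvP.2
      refine hP.mem_of_ssubset hK.down
        (Finset.insert_subset hvP.1 Finset.inter_subset_left) fun hsub => hxy ?_
      have hz : ∀ z ∈ P, z ∉ M → z = v := fun z hz hzM =>
        (Finset.mem_insert.1 (hsub hz)).resolve_right fun h => hzM (Finset.mem_inter.1 h).2
      rw [hz x hx hxM, hz y hy hyM]
    omega
  obtain ⟨M, hM, hAM⟩ := hK.exists_facet hA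
  have hρM : ρ ∈ M := hAM (Finset.mem_insert_self _ _)
  obtain ⟨q, hq, hqM⟩ := Finset.not_subset.1 fun hPM => hP.2.1 (hK.down _ hM.1 _ hPM)
  have hqM' : ∀ z ∈ P, z ≠ q → z ∈ M := fun z hz hzq => by
    by_contra hzM; exact hzq (key M hM hρM z hz q hq hzM hqM)
  by_cases hpq : p = q
  · subst hpq
    refine hK.down _ hM.1 _ (Finset.insert_subset hρM (Finset.union_subset ?_ ?_))
    · exact (Finset.subset_insert _ _).trans hAM
    · exact fun z hz => hqM' z (Finset.mem_of_mem_erase hz) (Finset.ne_of_mem_erase hz)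
  · have hpM := hqM' p hp hpq
    obtain ⟨r, hr, hrK⟩ := hK.exists_adjacent hM hpM
    obtain ⟨M', hM', hsub⟩ := hK.exists_facet hrK
    have hρp : ρ ≠ p := fun h => hρP (h ▸ hp)
    have hsub' : M.erase p ⊆ M' := (Finset.subset_insert _ _).trans hsub
    have hrM' : r ∈ M' := hsub (Finset.mem_insert_self _ _)
    have hpM' : p ∉ M' := fun hpM' => hr (by
      have : M ⊆ M' := fun z hz => by
        by_cases hzp : z = p
        · exact hzp ▸ hpM'
        · exact hsub' (Finset.mem_erase.2 ⟨hzp, hz⟩)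
      rw [← hM.2 _ hM'.1 this]; exact hrM')
    have hρM' : ρ ∈ M' := hsub' (Finset.mem_erase.2 ⟨hρp, hρM⟩)
    refine hK.down _ hM'.1 _ (Finset.insert_subset hρM' (Finset.union_subset ?_ ?_))
    · intro z hz
      refine hsub' (Finset.mem_erase.2 ⟨?_, hAM (Finset.mem_insert_of_mem hz)⟩)
      rintro rfl
      exact Finset.disjoint_left.1 hd hz hp
    · intro z hz
      have hz' := Finset.mem_erase.1 hz
      by_contra hzM'
      exact hz'.1 (key M' hM' hρM' z hz'.2 p hp hzM' hpM')

end IsLatticeFan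

/-! ### Star subdivisions and their inverses -/

/-- The star subdivision of the complex `K` along its member `P`: every member that contains `P`
is replaced by the sets that consist of the new vertex `∑ P` and a subset that does not
contain `P`. -/
def subdivision (K : Set (Finset N)) (P : Finset N) : Set (Finset N) :=
  {A | A ∈ K ∧ ¬ P ⊆ A} ∪
  {B | ∃ A ∈ K, ¬ P ⊆ A ∧ A ∪ P ∈ K ∧ B = insert (∑ v ∈ P, v) A}

/-- The complex obtained from `K` by the contraction of the vertex `∑ P` for a primitive set `P`,
the inverse of the star subdivision along `P`. -/
def contraction (K : Set (Finset N)) (P : Finset N) : Set (Finset N) :=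
  {A | ∑ v ∈ P, v ∉ A ∧ (A ∈ K ∨ (P ⊆ A ∧ insert (∑ v ∈ P, v) (A \ P) ∈ K))}

/-- The complete nonsingular fan `K` is the star subdivision of the complete nonsingular fan `K'`
along its member `P`, which has at least two elements. -/
structure IsSubdivision (K K' : Set (Finset N)) (P : Finset N) : Prop where
  isLatticeFan : IsLatticeFan K
  isLatticeFan' : IsLatticeFan K'
  mem : P ∈ K'
  two_le_card : 2 ≤ P.card
  eq : K = subdivision K' P

lemma IsLatticeFan.sum_notMem_of_mem {K : Set (Finset N)} (hK : IsLatticeFan K) {P : Finset N}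
    (hP : P ∈ K) (h2 : 2 ≤ P.card) {A : Finset N} (hA : A ∈ K) : ∑ v ∈ P, v ∉ A := fun h => by
  have := hK.eq_of_sum_eq (hK.singleton_mem hA h) hP (by simp)
  rw [← this] at h2
  simp at h2

/-- The star subdivision of a complete nonsingular fan is a complete nonsingular fan. -/
lemma IsLatticeFan.subdivision {K : Set (Finset N)} (hK : IsLatticeFan K) {P : Finset N}
    (hP : P ∈ K) (h2 : 2 ≤ P.card) : IsLatticeFan (subdivision K P) := by
  set ρ := ∑ v ∈ P, v with hρ
  have hρA : ∀ A ∈ K, ρ ∉ A := fun A hA => hK.sum_notMem_of_mem hP h2 hA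
  -- back in `K`, the coefficient of `ρ` is spread over the elements of `P`
  have back : ∀ f : N →₀ ℕ, f.support ∈ ToricFan.subdivision K P →
      (f.erase ρ + f ρ • indicator P).support ∈ K ∧
      latticeSum (f.erase ρ + f ρ • indicator P) = latticeSum f ∧ ∃ p ∈ P, f p = 0 := by
    intro f hf
    refine ⟨?_, ?_, ?_⟩
    · rcases hf with ⟨hf, -⟩ | ⟨A, hA, hPA, hAP, hf⟩
      · have : f ρ = 0 := Finsupp.notMem_support_iff.1 (hρA _ hf)
        rw [this, zero_smul, add_zero, Finsupp.support_erase]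
        exact hK.down _ hf _ (Finset.erase_subset _ _)
      · refine hK.down _ hAP _ fun v hv => ?_
        rcases Finset.mem_union.1 (Finsupp.support_add hv) with h | h
        · rw [Finsupp.support_erase, hf] at h
          exact Finset.mem_union_left _
            (Finset.mem_of_mem_insert_of_ne (Finset.mem_of_mem_erase h) (Finset.ne_of_mem_erase h))
        · have := Finsupp.support_smul h
          rw [support_indicator] at this
          exact Finset.mem_union_right _ this
    · conv_rhs => rw [← Finsupp.single_add_erase ρ f]
      rw [map_add, map_add, map_nsmul, latticeSum_indicator, Finsupp.linearCombination_single,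
        add_comm]
      rfl
    · rcases hf with ⟨hf, hPA⟩ | ⟨A, hA, hPA, hAP, hf⟩
      · obtain ⟨p, hp, hpf⟩ := Finset.not_subset.1 hPA
        exact ⟨p, hp, Finsupp.notMem_support_iff.1 hpf⟩
      · obtain ⟨p, hp, hpf⟩ := Finset.not_subset.1 hPA
        refine ⟨p, hp, Finsupp.notMem_support_iff.1 ?_⟩
        rw [hf]
        intro h
        rcases Finset.mem_insert.1 h with h | h
        · exact hρA _ hP (by rw [hρ, ← h]; exact hp)
        · exact hpf h
  refine ⟨?_, ?_, ?_, ?_⟩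
  · refine (hK.finite.union (hK.finite.image fun A => insert ρ A)).subset ?_
    rintro A (⟨hA, -⟩ | ⟨B, hB, -, -, rfl⟩)
    · exact Or.inl hA
    · exact Or.inr ⟨B, hB, rfl⟩
  · rintro S (⟨hS, hPS⟩ | ⟨A, hA, hPA, hAP, rfl⟩) T hT
    · exact Or.inl ⟨hK.down _ hS _ hT, fun h => hPS (h.trans hT)⟩
    · have hTA : T.erase ρ ⊆ A := fun v hv =>
        Finset.mem_of_mem_insert_of_ne (hT (Finset.mem_of_mem_erase hv)) (Finset.ne_of_mem_erase hv)
      by_cases hρT : ρ ∈ T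
      · exact Or.inr ⟨T.erase ρ, hK.down _ hA _ hTA, fun h => hPA (h.trans hTA),
          hK.down _ hAP _ (Finset.union_subset_union_left hTA), (Finset.insert_erase hρT).symm⟩
      · rw [Finset.erase_eq_of_notMem hρT] at hTA
        exact Or.inl ⟨hK.down _ hA _ hTA, fun h => hPA (h.trans hTA)⟩
  · intro f g hf hg hfg
    obtain ⟨f1, f2, p, hp, hfp⟩ := back f hf
    obtain ⟨g1, g2, q, hq, hgq⟩ := back g hg
    have h := hK.inj _ _ f1 g1 (by rw [f2, g2, hfg])
    have hne : ∀ v ∈ P, v ≠ ρ := fun v hv h => hρA P hP (h ▸ hv)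
    have hv : ∀ v ∈ P, f v + f ρ = g v + g ρ := fun v hv => by
      have := DFunLike.congr_fun h v
      simpa [indicator_apply, hv, Finsupp.erase_ne (hne v hv)] using this
    have hρ' : f ρ = g ρ := by
      have a := hv p hp
      have b := hv q hq
      omega
    ext v
    by_cases hvρ : v = ρ
    · rw [hvρ, hρ']
    by_cases hvP : v ∈ P
    · have := hv v hvP; omega
    · have := DFunLike.congr_fun h v
      simpa [indicator_apply, hvP, Finsupp.erase_ne hvρ] using this
  · intro x
    obtain ⟨f, hf, hfx⟩ := hK.surj x
    obtain ⟨p, hp, hmin⟩ := Finset.exists_min_image P f (Finset.card_pos.1 (by omega))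
    have hle : f p • indicator P ≤ f := fun v => by
      rw [Finsupp.smul_apply, indicator_apply]
      split_ifs with h
      · simpa using hmin v h
      · simp
    have hsub : (f - f p • indicator P).support ⊆ f.support := fun v hv => by
      simp only [Finsupp.mem_support_iff, Finsupp.tsub_apply] at hv ⊢; omega
    have hpn : p ∉ (f - f p • indicator P).support := by simp [indicator_apply, hp]
    have hBK := hK.down _ hf _ hsub
    have hsum : latticeSum (f - f p • indicator P) + f p • ρ = x := by
      rw [hρ, ← latticeSum_indicator, ← map_nsmul, ← map_add, tsub_add_cancel_of_le hle, hfx]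
    by_cases h0 : f p = 0
    · refine ⟨f, Or.inl ⟨hf, fun h => ?_⟩, hfx⟩
      exact Finsupp.mem_support_iff.1 (h hp) h0
    · refine ⟨(f - f p • indicator P) + Finsupp.single ρ (f p), Or.inr
        ⟨(f - f p • indicator P).support, hBK, fun h => hpn (h hp),
          hK.down _ hf _ (Finset.union_subset hsub fun v hv => ?_), ?_⟩, ?_⟩
      · have := hmin v hv
        rw [Finsupp.mem_support_iff]; omega
      · ext v
        by_cases hvρ : v = ρ
        · rw [hvρ, ← hρ]; simp [h0]
        · rw [Finset.mem_insert]
          simp only [Finsupp.mem_support_iff, Finsupp.add_apply]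
          rw [Finsupp.single_eq_of_ne hvρ, add_zero]
          exact ⟨Or.inr, fun h => h.resolve_left hvρ⟩
      · rw [map_add, Finsupp.linearCombination_single]
        exact hsum

namespace IsSubdivision

variable {K K' : Set (Finset N)} {P : Finset N} (h : IsSubdivision K K' P)
include h

lemma sum_notMem {A : Finset N} (hA : A ∈ K') : ∑ v ∈ P, v ∉ A :=
  h.isLatticeFan'.sum_notMem_of_mem h.mem h.two_le_card hA

lemma mem_iff {A : Finset N} (hA : ∑ v ∈ P, v ∉ A) : A ∈ K ↔ A ∈ K' ∧ ¬ P ⊆ A := by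
  rw [h.eq]
  refine ⟨?_, Or.inl⟩
  rintro (hA' | ⟨B, -, -, -, rfl⟩)
  · exact hA'
  · exact absurd (Finset.mem_insert_self _ _) hA

lemma insert_mem_iff {A : Finset N} (hA : ∑ v ∈ P, v ∉ A) :
    insert (∑ v ∈ P, v) A ∈ K ↔ A ∈ K' ∧ ¬ P ⊆ A ∧ A ∪ P ∈ K' := by
  rw [h.eq]
  constructor
  · rintro (⟨hA', -⟩ | ⟨B, hB, hPB, hBP, hAB⟩)
    · exact absurd (Finset.mem_insert_self _ _) (h.sum_notMem hA')
    · have hAB : A = B := by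
        rw [← Finset.erase_insert hA, hAB, Finset.erase_insert (h.sum_notMem hB)]
      subst hAB
      exact ⟨hB, hPB, hBP⟩
  · rintro ⟨hA', hPA, hAP⟩
    exact Or.inr ⟨A, hA', hPA, hAP, rfl⟩

lemma nonempty : P.Nonempty := Finset.card_pos.1 (by have := h.two_le_card; omega)

lemma not_subset_singleton (v : N) : ¬ P ⊆ {v} := fun hP => by
  have := Finset.card_le_card hP
  have := h.two_le_card
  simp at *
  omega

lemma sum_mem : {∑ v ∈ P, v} ∈ K := by
  have := (h.insert_mem_iff (A := ∅) (by simp)).2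
    ⟨h.isLatticeFan'.empty_mem, fun hP => by
      have := h.nonempty; rw [Finset.subset_empty.1 hP] at this; simp at this,
      by simpa using h.mem⟩
  simpa using this

lemma vertex_iff {v : N} : {v} ∈ K' ↔ {v} ∈ K ∧ v ≠ ∑ v ∈ P, v := by
  constructor
  · intro hv
    have hne : ∑ v ∈ P, v ∉ ({v} : Finset N) := h.sum_notMem hv
    exact ⟨(h.mem_iff hne).2 ⟨hv, h.not_subset_singleton v⟩, fun h' => hne (by simp [h'])⟩
  · rintro ⟨hv, hne⟩
    exact ((h.mem_iff (by simpa using hne.symm)).1 hv).1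

lemma isPrimitive : IsPrimitive K P := by
  have hP := h.sum_notMem h.mem
  refine ⟨fun v hv => (h.vertex_iff.1 (h.isLatticeFan'.singleton_mem h.mem hv)).1,
    fun hPK => ((h.mem_iff hP).1 hPK).2 subset_rfl, fun v hv => ?_⟩
  refine (h.mem_iff fun hm => hP (Finset.mem_of_mem_erase hm)).2
    ⟨h.isLatticeFan'.down _ h.mem _ (Finset.erase_subset _ _), fun hs => ?_⟩
  exact Finset.notMem_erase v P (hs hv)

/-- A primitive set of the blow-down comes from a primitive set of `K` with the same sum: either it
is one itself, or it contains `P`, and `P` has to be replaced by its sum. -/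
lemma exists_primitive {Q : Finset N} (hQ : IsPrimitive K' Q) :
    (¬ P ⊆ Q ∧ IsPrimitive K Q) ∨
    (P ⊆ Q ∧ IsPrimitive K (insert (∑ v ∈ P, v) (Q \ P)) ∧
      ∑ v ∈ insert (∑ v ∈ P, v) (Q \ P), v = ∑ v ∈ Q, v) := by
  have hρQ : ∑ v ∈ P, v ∉ Q := fun hm => h.sum_notMem (hQ.1 _ hm) (Finset.mem_singleton_self _)
  have hvQ : ∀ v ∈ Q, {v} ∈ K := fun v hv => (h.vertex_iff.1 (hQ.1 v hv)).1
  by_cases hPQ : P ⊆ Q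
  · right
    have hρC : ∑ v ∈ P, v ∉ Q \ P := fun hm => hρQ (Finset.mem_sdiff.1 hm).1
    have hnP : ∀ A ⊆ Q \ P, ¬ P ⊆ A := fun A hA hPA => by
      obtain ⟨p, hp⟩ := h.nonempty
      exact (Finset.mem_sdiff.1 (hA (hPA hp))).2 hp
    refine ⟨hPQ, ⟨?_, ?_, ?_⟩, ?_⟩
    · intro v hv
      rcases Finset.mem_insert.1 hv with rfl | hv
      · exact h.sum_mem
      · exact hvQ v (Finset.mem_sdiff.1 hv).1
    · intro hm
      have := ((h.insert_mem_iff hρC).1 hm).2.2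
      rw [Finset.sdiff_union_of_subset hPQ] at this
      exact hQ.2.1 this
    · intro v hv
      rcases Finset.mem_insert.1 hv with rfl | hv
      · rw [Finset.erase_insert hρC, h.mem_iff hρC]
        obtain ⟨p, hp⟩ := h.nonempty
        refine ⟨h.isLatticeFan'.down _ (hQ.2.2 p (hPQ hp)) _ fun w hw => ?_, hnP _ subset_rfl⟩
        have hw' := Finset.mem_sdiff.1 hw
        exact Finset.mem_erase.2 ⟨fun e => hw'.2 (e ▸ hp), hw'.1⟩
      · have hne : v ≠ ∑ v ∈ P, v := fun e => hρC (e ▸ hv)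
        have hv' := Finset.mem_sdiff.1 hv
        rw [Finset.erase_insert_of_ne hne.symm,
          h.insert_mem_iff (fun hm => hρC (Finset.mem_of_mem_erase hm))]
        have hK := hQ.2.2 v hv'.1
        refine ⟨h.isLatticeFan'.down _ hK _ (Finset.erase_subset_erase _ Finset.sdiff_subset),
          hnP _ (Finset.erase_subset _ _), h.isLatticeFan'.down _ hK _ ?_⟩
        refine Finset.union_subset (Finset.erase_subset_erase _ Finset.sdiff_subset) fun p hp => ?_
        exact Finset.mem_erase.2 ⟨fun e => hv'.2 (e ▸ hp), hPQ hp⟩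
    · rw [Finset.sum_insert hρC, add_comm, Finset.sum_sdiff hPQ]
  · refine Or.inl ⟨hPQ, hvQ, fun hm => hQ.2.1 ((h.mem_iff hρQ).1 hm).1, fun v hv => ?_⟩
    exact (h.mem_iff fun hm => hρQ (Finset.mem_of_mem_erase hm)).2
      ⟨hQ.2.2 v hv, fun hs => hPQ (hs.trans (Finset.erase_subset _ _))⟩

lemma exists_primitive_sum_eq {Q : Finset N} (hQ : IsPrimitive K' Q) :
    ∃ Q', IsPrimitive K Q' ∧ ∑ v ∈ Q', v = ∑ v ∈ Q, v := by
  rcases h.exists_primitive hQ with h1 | h1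
  · exact ⟨Q, h1.2, rfl⟩
  · exact ⟨_, h1.2⟩

lemma isPrimitive_of_notMem {Q : Finset N} (hQ : IsPrimitive K Q) (hρ : ∑ v ∈ P, v ∉ Q)
    (hne : Q ≠ P) : IsPrimitive K' Q := by
  have hPQ : ¬ P ⊆ Q := fun hPQ => by
    refine h.isPrimitive.2.1 (hQ.mem_of_ssubset h.isLatticeFan.down hPQ fun hQP => ?_)
    exact hne (hQP.antisymm hPQ)
  refine ⟨fun v hv => h.vertex_iff.2 ⟨hQ.1 v hv, fun e => hρ (e ▸ hv)⟩,
    fun hm => hQ.2.1 ((h.mem_iff hρ).2 ⟨hm, hPQ⟩), fun v hv => ?_⟩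
  exact ((h.mem_iff fun hm => hρ (Finset.mem_of_mem_erase hm)).1 (hQ.2.2 v hv)).1

/-- That sums of primitive sets are distinct is needed here: a primitive set of the blow-down must
not sum to the contracted vertex. -/
lemma hasShortRelations (hs : HasShortRelations K) (hd : HasDistinctSums K) :
    HasShortRelations K' := by
  intro Q hQ
  obtain ⟨Q', hQ', hsum⟩ := h.exists_primitive_sum_eq hQ
  rw [← hsum]
  refine (hs Q' hQ').imp_right fun hv => h.vertex_iff.2 ⟨hv, fun e => ?_⟩
  have hPQ := hd P Q' h.isPrimitive hQ' (e ▸ hv) e.symm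
  rcases h.exists_primitive hQ with ⟨h1, h2⟩ | ⟨h1, h2, h3⟩
  · have := hd P Q h.isPrimitive h2 (e ▸ hv) (e.symm.trans hsum)
    exact h1 (this ▸ subset_rfl)
  · have := hd P _ h.isPrimitive h2 (e ▸ hv) ((e.symm.trans hsum).trans h3.symm)
    have hm : ∑ v ∈ P, v ∈ P := by
      have hm : ∑ v ∈ P, v ∈ insert (∑ v ∈ P, v) (Q \ P) := Finset.mem_insert_self _ _
      rwa [← this] at hm
    exact h.sum_notMem h.mem hm

lemma hasDistinctSums (hd : HasDistinctSums K) : HasDistinctSums K' := by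
  intro Q R hQ hR hv hQR
  have hρ : ∀ Q, IsPrimitive K' Q → ∑ v ∈ P, v ∉ Q := fun Q hQ hm =>
    h.sum_notMem (hQ.1 _ hm) (Finset.mem_singleton_self _)
  have hv' := (h.vertex_iff.1 hv).1
  rcases h.exists_primitive hQ with ⟨h1, h2⟩ | ⟨h1, h2, h3⟩ <;>
    rcases h.exists_primitive hR with ⟨h4, h5⟩ | ⟨h4, h5, h6⟩
  · exact hd Q R h2 h5 hv' hQR
  · have := hd Q _ h2 h5 hv' (hQR.trans h6.symm)
    refine absurd ?_ (hρ Q hQ)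
    rw [this]
    exact Finset.mem_insert_self _ _
  · have := hd R _ h5 h2 (hQR ▸ hv') (hQR.symm.trans h3.symm)
    refine absurd ?_ (hρ R hR)
    rw [this]
    exact Finset.mem_insert_self _ _
  · have := hd _ _ h2 h5 (h3 ▸ hv') (h3.trans (hQR.trans h6.symm))
    have h7 : Q \ P = R \ P := by
      rw [← Finset.erase_insert (a := ∑ v ∈ P, v) (s := Q \ P)
          (fun hm => hρ Q hQ (Finset.mem_sdiff.1 hm).1), this,
        Finset.erase_insert (fun hm => hρ R hR (Finset.mem_sdiff.1 hm).1)]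
    rw [← Finset.sdiff_union_of_subset h1, h7, Finset.sdiff_union_of_subset h4]

end IsSubdivision

/-- If the primitive set `P` sums to a vertex, that vertex can be contracted. -/
theorem IsLatticeFan.isSubdivision_contraction {K : Set (Finset N)} (hK : IsLatticeFan K)
    (hs : HasShortRelations K) {P : Finset N} (hP : IsPrimitive K P) (hρK : {∑ v ∈ P, v} ∈ K) :
    IsSubdivision K (contraction K P) P := by
  have hc := fun (A : Finset N) hA hd (p : N) hp =>
    hK.union_erase_mem hs (A := A) (p := p) hP hA hd hp
  have hρP : ∑ v ∈ P, v ∉ P := hK.sum_notMem hP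
  have h2 := hK.two_le_card hP
  have hPK' : P ∈ contraction K P :=
    ⟨hρP, Or.inr ⟨subset_rfl, by simpa using hρK⟩⟩
  set ρ := ∑ v ∈ P, v with hρ
  -- a combination supported on the contraction is one supported on `K`, with `ρ` split up
  have key : ∀ f : N →₀ ℕ, f.support ∈ contraction K P → ∃ (m : ℕ) (g : N →₀ ℕ), g ρ = 0 ∧
      f = m • indicator P + g ∧ (Finsupp.single ρ m + g).support ∈ K := by
    rintro f ⟨hρf, hf | ⟨hPf, hf⟩⟩
    · exact ⟨0, f, Finsupp.notMem_support_iff.1 hρf, by simp, by simpa⟩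
    · obtain ⟨p, hp, hmin⟩ := Finset.exists_min_image P f (Finset.card_pos.1 (by omega))
      have hle : f p • indicator P ≤ f := fun v => by
        rw [Finsupp.smul_apply, indicator_apply]
        split_ifs with h
        · simpa using hmin v h
        · simp
      refine ⟨f p, f - f p • indicator P, ?_, (add_tsub_cancel_of_le hle).symm, ?_⟩
      · rw [Finsupp.tsub_apply, Finsupp.notMem_support_iff.1 hρf, zero_tsub]
      · refine hK.down _ (hc _ hf Finset.sdiff_disjoint p hp) _ fun v hv => ?_
        rcases Finset.mem_union.1 (Finsupp.support_add hv) with h | h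
        · have := Finsupp.support_single_subset h
          rw [Finset.mem_singleton] at this
          exact Finset.mem_insert.2 (Or.inl this)
        · refine Finset.mem_insert_of_mem (Finset.mem_union.2 ?_)
          have hvf : v ∈ f.support := by
            simp only [Finsupp.mem_support_iff, Finsupp.tsub_apply] at h ⊢; omega
          by_cases hvP : v ∈ P
          · refine Or.inr (Finset.mem_erase.2 ⟨?_, hvP⟩)
            rintro rfl
            simp [indicator_apply, hvP] at h
          · exact Or.inl (Finset.mem_sdiff.2 ⟨hvf, hvP⟩)
  have hK' : IsLatticeFan (contraction K P) := by
    refine ⟨?_, ?_, ?_, ?_⟩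
    · refine (hK.finite.union (hK.finite.image fun A => A.erase ρ ∪ P)).subset ?_
      rintro A ⟨hρA, hA | ⟨hPA, hA⟩⟩
      · exact Or.inl hA
      · refine Or.inr ⟨_, hA, ?_⟩
        change Finset.erase (insert ρ (A \ P)) ρ ∪ P = A
        rw [Finset.erase_insert (fun h => hρA (Finset.mem_sdiff.1 h).1),
          Finset.sdiff_union_of_subset hPA]
    · rintro A ⟨hρA, hA | ⟨hPA, hA⟩⟩ B hB
      · exact ⟨fun h => hρA (hB h), Or.inl (hK.down _ hA _ hB)⟩
      · refine ⟨fun h => hρA (hB h), ?_⟩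
        by_cases hPB : P ⊆ B
        · exact Or.inr ⟨hPB, hK.down _ hA _
            (Finset.insert_subset_insert _ (Finset.sdiff_subset_sdiff hB subset_rfl))⟩
        · obtain ⟨p, hp, hpB⟩ := Finset.not_subset.1 hPB
          refine Or.inl (hK.down _ (hc _ hA Finset.sdiff_disjoint p hp) _ fun v hv => ?_)
          refine Finset.mem_insert_of_mem (Finset.mem_union.2 ?_)
          by_cases hvP : v ∈ P
          · exact Or.inr (Finset.mem_erase.2 ⟨fun e => hpB (e ▸ hv), hvP⟩)
          · exact Or.inl (Finset.mem_sdiff.2 ⟨hB hv, hvP⟩)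
    · intro f f' hf hf' hff
      obtain ⟨m, g, hg, rfl, hm⟩ := key f hf
      obtain ⟨m', g', hg', rfl, hm'⟩ := key f' hf'
      have h := hK.inj _ _ hm hm' (by
        simp only [map_add, map_nsmul, latticeSum_indicator, Finsupp.linearCombination_single,
          id] at hff ⊢
        exact hff)
      have hmm : m = m' := by
        have := DFunLike.congr_fun h ρ
        simpa [hg, hg'] using this
      subst hmm
      rw [add_right_inj] at h
      rw [h]
    · intro x
      obtain ⟨f, hf, hfx⟩ := hK.surj x
      by_cases hfρ : ρ ∈ f.support
      · refine ⟨f.erase ρ + f ρ • indicator P, ?_, ?_⟩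
        · have hsupp : (f.erase ρ + f ρ • indicator P).support = f.support.erase ρ ∪ P := by
            have := Finsupp.mem_support_iff.1 hfρ
            ext v
            by_cases hvρ : v = ρ
            · subst hvρ; simp [indicator_apply, hρP]
            · by_cases hvP : v ∈ P
              · simp [indicator_apply, hvP, this]
              · simp [indicator_apply, hvP, Finsupp.erase_ne hvρ, hvρ]
          rw [hsupp]
          refine ⟨?_, Or.inr ⟨Finset.subset_union_right, hK.down _ hf _ ?_⟩⟩
          · simp only [Finset.mem_union, Finset.mem_erase, not_or]
            exact ⟨fun h => h.1 rfl, hρP⟩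
          · refine Finset.insert_subset hfρ fun v hv => ?_
            have hv' := Finset.mem_sdiff.1 hv
            exact Finset.mem_of_mem_erase ((Finset.mem_union.1 hv'.1).resolve_right hv'.2)
        · rw [← hfx]
          conv_rhs => rw [← Finsupp.single_add_erase ρ f]
          rw [map_add, map_add, map_nsmul, latticeSum_indicator, Finsupp.linearCombination_single,
            add_comm]
          rfl
      · exact ⟨f, ⟨hfρ, Or.inl hf⟩, hfx⟩
  refine ⟨hK, hK', hPK', h2, Set.Subset.antisymm ?_ ?_⟩
  · intro A hA
    by_cases hρA : ρ ∈ A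
    · have hB := hK.down _ hA _ (Finset.erase_subset ρ A)
      have hρB : ρ ∉ A.erase ρ := Finset.notMem_erase _ _
      refine Or.inr ⟨A.erase ρ, ⟨hρB, Or.inl hB⟩, fun h => hP.2.1 (hK.down _ hB _ h),
        ⟨?_, Or.inr ⟨Finset.subset_union_right, hK.down _ hA _ ?_⟩⟩, (Finset.insert_erase hρA).symm⟩
      · rw [Finset.mem_union, not_or]; exact ⟨hρB, hρP⟩
      · refine Finset.insert_subset hρA fun v hv => ?_
        have hv' := Finset.mem_sdiff.1 hv
        exact Finset.mem_of_mem_erase ((Finset.mem_union.1 hv'.1).resolve_right hv'.2)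
    · exact Or.inl ⟨⟨hρA, Or.inl hA⟩, fun h => hP.2.1 (hK.down _ hA _ h)⟩
  · rintro A (⟨⟨hρA, hA | hA⟩, hPA⟩ | ⟨B, hB, hPB, ⟨hρ', hBP | ⟨-, hBP⟩⟩, rfl⟩)
    · exact hA
    · exact absurd hA.1 hPA
    · exact absurd (hK.down _ hBP _ Finset.subset_union_right) hP.2.1
    · obtain ⟨p, hp, hpB⟩ := Finset.not_subset.1 hPB
      refine hK.down _ (hc _ hBP Finset.sdiff_disjoint p hp) _
        (Finset.insert_subset_insert _ fun v hv => ?_)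
      by_cases hvP : v ∈ P
      · exact Finset.mem_union_right _ (Finset.mem_erase.2 ⟨fun e => hpB (e ▸ hv), hvP⟩)
      · exact Finset.mem_union_left _
          (Finset.mem_sdiff.2 ⟨Finset.mem_union_left _ hv, hvP⟩)

/-- If all blow-downs are Fano, a vertex is the sum of at most one primitive set: the relation
`∑ P = ∑ Q` persists in the contraction along `P`, where `P` is a cone and `Q` is primitive, so
that `P` has fewer elements than `Q`, and conversely. -/
theorem IsLatticeFan.hasDistinctSums {K : Set (Finset N)} (hK : IsLatticeFan K)
    (hs : HasShortRelations K)
    (hF : ∀ K' P, IsSubdivision K K' P → IsStarFano K' ∅) : HasDistinctSums K := by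
  have key : ∀ P Q, IsPrimitive K P → IsPrimitive K Q → {∑ v ∈ P, v} ∈ K →
      ∑ v ∈ P, v = ∑ v ∈ Q, v → Q ≠ P → P.card < Q.card := by
    intro P Q hP hQ hv hPQ hne
    have h := hK.isSubdivision_contraction hs hP hv
    have hQ' := h.isPrimitive_of_notMem hQ (by rw [hPQ]; exact hK.sum_notMem hQ) hne
    exact h.isLatticeFan'.card_lt_card (hF _ _ h) h.mem hQ' hPQ
  intro P Q hP hQ hv hPQ
  by_contra hne
  have h1 := key P Q hP hQ hv hPQ (Ne.symm hne)
  have h2 := key Q P hQ hP (hPQ ▸ hv) hPQ.symm hne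
  omega

/-- Two successive contractions may be exchanged. Contract first the vertex `ρ₂` that was contracted
last, along a primitive set `Q`. If `ρ₂` is not in `P`, then `P` stays primitive; otherwise `ρ₂` has
to be replaced in `P` by the elements of `Q`. The result is the same fan as before, since it is
Fano and has the same vertices. -/
theorem IsSubdivision.exists_swap {K K₁ K₂ : Set (Finset N)} {P Q₁ : Finset N}
    (h₁ : IsSubdivision K K₁ P) (h₂ : IsSubdivision K₁ K₂ Q₁) (hs : HasShortRelations K)
    (hd : HasDistinctSums K) :
    ∃ K' Q R, IsSubdivision K K' Q ∧ IsSubdivision K' K₂ R ∧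
      ∑ v ∈ Q, v = ∑ v ∈ Q₁, v ∧ ∑ v ∈ R, v = ∑ v ∈ P, v := by
  have hK := h₁.isLatticeFan
  have hs₁ := h₁.hasShortRelations hs hd
  have hd₁ := h₁.hasDistinctSums hd
  -- the vertex `∑ Q₁` is already the sum of a primitive set of `K`
  obtain ⟨Q, hQ, hsum⟩ := h₁.exists_primitive_sum_eq h₂.isPrimitive
  have hv₂ := h₁.vertex_iff.1 h₂.sum_mem
  have h' := hK.isSubdivision_contraction hs hQ (hsum ▸ hv₂.1)
  have hs' := h'.hasShortRelations hs hd
  have hd' := h'.hasDistinctSums hd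
  have hPv : {∑ v ∈ P, v} ∈ contraction K Q :=
    h'.vertex_iff.2 ⟨h₁.sum_mem, fun e => hv₂.2 (hsum ▸ e.symm)⟩
  -- it remains to find a primitive set of the contraction with the sum of `P`
  suffices hR : ∃ R, IsPrimitive (contraction K Q) R ∧ ∑ v ∈ R, v = ∑ v ∈ P, v by
    obtain ⟨R, hR, hRP⟩ := hR
    have h'' := h'.isLatticeFan'.isSubdivision_contraction hs' hR (hRP ▸ hPv)
    refine ⟨_, Q, R, h', ?_, hsum, hRP⟩
    have heq : contraction (contraction K Q) R = K₂ := by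
      refine h''.isLatticeFan'.eq_of_vertices_eq
        (h''.isLatticeFan'.isStarFano (h''.hasShortRelations hs' hd') ∅) h₂.isLatticeFan'
        (h₂.isLatticeFan'.isStarFano (h₂.hasShortRelations hs₁ hd₁) ∅) fun v => ?_
      rw [h''.vertex_iff, h'.vertex_iff, h₂.vertex_iff, h₁.vertex_iff, hRP, hsum]
      tauto
    rwa [heq] at h''
  by_cases hQP : ∑ v ∈ Q, v ∈ P
  · have hQ₁P : ¬ P ⊆ Q₁ := fun hsub =>
      h₁.isLatticeFan'.sum_notMem h₂.isPrimitive (hsub (hsum ▸ hQP))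
    have hQ₁ : Q₁ = Q := by
      rcases h₁.exists_primitive h₂.isPrimitive with h3 | h3
      · exact hd _ _ h3.2 hQ hv₂.1 hsum.symm
      · exact absurd h3.1 hQ₁P
    subst hQ₁
    set ρ₂ := ∑ v ∈ Q₁, v with hρ₂
    have hPi : insert ρ₂ (P.erase ρ₂) = P := Finset.insert_erase hQP
    have hρD : ρ₂ ∉ P.erase ρ₂ := Finset.notMem_erase _ _
    have hρQ : ρ₂ ∉ Q₁ := hK.sum_notMem hQ
    have hDK : P.erase ρ₂ ∈ K := h₁.isPrimitive.2.2 _ hQP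
    have hnQ : ∀ A ∈ K, ¬ Q₁ ⊆ A := fun A hA h => hQ.2.1 (hK.down _ hA _ h)
    have hnm : Q₁ ∪ P.erase ρ₂ ∉ contraction K Q₁ := fun hm => by
      refine h₁.isPrimitive.2.1 ?_
      rw [← hPi, h'.insert_mem_iff hρD]
      refine ⟨h'.isLatticeFan'.down _ hm _ Finset.subset_union_right, hnQ _ hDK, ?_⟩
      rwa [Finset.union_comm]
    have herase : ∀ d ∈ P.erase ρ₂, Q₁ ∪ (P.erase ρ₂).erase d ∈ contraction K Q₁ := by
      intro d hd
      have hρ' : ρ₂ ∉ (P.erase ρ₂).erase d := fun h => hρD (Finset.mem_of_mem_erase h)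
      have hm : insert ρ₂ ((P.erase ρ₂).erase d) ∈ K := by
        rw [← Finset.erase_insert_of_ne (Finset.ne_of_mem_erase hd).symm, hPi]
        exact h₁.isPrimitive.2.2 d (Finset.mem_of_mem_erase hd)
      rw [Finset.union_comm]
      exact ((h'.insert_mem_iff hρ').1 hm).2.2
    have hdisj : Disjoint Q₁ (P.erase ρ₂) := Finset.disjoint_left.2 fun d hdQ hdD => by
      have := herase d hdD
      refine hnm (h'.isLatticeFan'.down _ this _ fun v hv => ?_)
      by_cases hvd : v = d
      · exact Finset.mem_union_left _ (hvd ▸ hdQ)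
      · exact (Finset.mem_union.1 hv).elim (Finset.mem_union_left _)
          fun h => Finset.mem_union_right _ (Finset.mem_erase.2 ⟨hvd, h⟩)
    refine ⟨Q₁ ∪ P.erase ρ₂, ⟨?_, hnm, ?_⟩, ?_⟩
    · intro v hv
      refine h'.vertex_iff.2 ⟨?_, fun e => ?_⟩
      · rcases Finset.mem_union.1 hv with hv | hv
        · exact hQ.1 v hv
        · exact hK.singleton_mem hDK hv
      · rcases Finset.mem_union.1 hv with hv | hv
        · exact hρQ (e.trans hρ₂.symm ▸ hv)
        · exact hρD (e.trans hρ₂.symm ▸ hv)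
    · intro v hv
      rcases Finset.mem_union.1 hv with hv | hv
      · -- here the contraction of `∑ Q₁` in `K₁` enters, for which `P` is a cone
        have hPK₁ : insert ρ₂ (P.erase ρ₂) ∈ K₁ := hPi.symm ▸ h₁.mem
        obtain ⟨-, -, hDQ⟩ := (h₂.insert_mem_iff hρD).1 hPK₁
        have hsub : (Q₁ ∪ P.erase ρ₂).erase v ⊆ P.erase ρ₂ ∪ Q₁ := by
          rw [Finset.union_comm]; exact Finset.erase_subset _ _
        have hρ' : ρ₂ ∉ (Q₁ ∪ P.erase ρ₂).erase v := fun h => by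
          rcases Finset.mem_union.1 (Finset.mem_of_mem_erase h) with h | h
          · exact hρQ h
          · exact hρD h
        have hm₁ : (Q₁ ∪ P.erase ρ₂).erase v ∈ K₁ := (h₂.mem_iff hρ').2
          ⟨h₂.isLatticeFan'.down _ hDQ _ hsub, fun h => Finset.notMem_erase _ _ (h hv)⟩
        have hm : (Q₁ ∪ P.erase ρ₂).erase v ∈ K := (h₁.mem_iff (h₁.sum_notMem hm₁)).2
          ⟨hm₁, fun h => hρ' (h hQP)⟩
        exact ((h'.mem_iff hρ').1 hm).1
      · have hvQ : v ∉ Q₁ := fun h => Finset.disjoint_left.1 hdisj h hv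
        refine h'.isLatticeFan'.down _ (herase v hv) _ ?_
        rw [Finset.erase_union_distrib, Finset.erase_eq_of_notMem hvQ]
    · rw [Finset.sum_union hdisj, Finset.add_sum_erase P (fun v => v) hQP]
  · refine ⟨P, h'.isPrimitive_of_notMem h₁.isPrimitive hQP ?_, rfl⟩
    rintro rfl
    exact hv₂.2 hsum.symm

end Combinatorial

section RealCones

variable {N : Type*} [AddCommGroup N]

/-! ### Cones generated by a part of a lattice basis -/

lemma tmul_mem_cone {S : Set N} {v : N} (hv : v ∈ S) : (1 : ℝ) ⊗ₜ[ℤ] v ∈ cone S :=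
  Submodule.subset_span ⟨v, hv, rfl⟩

lemma cone_le_iff {S : Set N} {C : PointedCone ℝ (RealSpace N)} :
    cone S ≤ C ↔ ∀ v ∈ S, (1 : ℝ) ⊗ₜ[ℤ] v ∈ C := by
  rw [cone, PointedCone.hull, Submodule.span_le]
  simp [Set.subset_def]

lemma cone_mono {S T : Set N} (h : S ⊆ T) : cone S ≤ cone T :=
  cone_le_iff.2 fun _ hv => tmul_mem_cone (h hv)

lemma cone_union (S T : Set N) : cone (S ∪ T) = cone S ⊔ cone T := by
  rw [cone, Set.image_union]; exact Submodule.span_union _ _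

lemma map_cone {N' : Type*} [AddCommGroup N'] (f : N →ₗ[ℤ] N') (S : Set N) :
    (cone S).map (realMap f) = cone (f '' S) := by
  rw [cone, cone, PointedCone.map, PointedCone.hull, Submodule.map_span, PointedCone.hull,
    ← Set.image_comp, ← Set.image_comp]
  congr 1

lemma sum_mem_cone {S : Finset N} {c : N → ℝ} (hc : ∀ v ∈ S, 0 ≤ c v) :
    ∑ v ∈ S, c v • ((1 : ℝ) ⊗ₜ[ℤ] v) ∈ cone (S : Set N) :=
  Submodule.sum_mem _ fun v hv => PointedCone.smul_mem _ (hc v hv) (tmul_mem_cone hv)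

lemma mem_cone_finset {S : Finset N} {x : RealSpace N} : x ∈ cone (S : Set N) ↔
    ∃ c : N → ℝ, (∀ v, 0 ≤ c v) ∧ ∑ v ∈ S, c v • ((1 : ℝ) ⊗ₜ[ℤ] v) = x := by
  constructor
  · rw [cone, PointedCone.hull, Submodule.mem_span_image_finset_iff_exists_fun]
    rintro ⟨c, hc⟩
    refine ⟨fun v => if h : v ∈ S then (c ⟨v, h⟩ : ℝ) else 0, fun v => ?_, ?_⟩
    · dsimp only
      split_ifs with h
      · exact (c ⟨v, h⟩).2
      · exact le_rfl
    · rw [← hc, ← Finset.sum_coe_sort]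
      refine Finset.sum_congr rfl fun i _ => ?_
      dsimp only
      rw [dif_pos i.2]
      rfl
  · rintro ⟨c, h0, rfl⟩
    exact sum_mem_cone fun v _ => h0 v

section Basis

variable {ι : Type*} (b : Module.Basis ι ℤ N)

lemma baseChange_repr_one_tmul (y : N) (i : ι) :
    (b.baseChange ℝ).repr ((1 : ℝ) ⊗ₜ[ℤ] y) i = (b.repr y i : ℝ) := by
  simp

lemma one_tmul_injective (b : Module.Basis ι ℤ N) {y z : N}
    (h : (1 : ℝ) ⊗ₜ[ℤ] y = (1 : ℝ) ⊗ₜ[ℤ] z) : y = z := by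
  refine b.ext_elem fun i => ?_
  have := congrArg (fun x => (b.baseChange ℝ).repr x i) h
  simp only [baseChange_repr_one_tmul] at this
  exact_mod_cast this

variable [Finite ι]

lemma mem_cone_basis {s : Set ι} {x : RealSpace N} : x ∈ cone (b '' s) ↔
    ∀ i, 0 ≤ (b.baseChange ℝ).repr x i ∧ (i ∉ s → (b.baseChange ℝ).repr x i = 0) := by
  constructor
  · intro hx
    induction hx using Submodule.span_induction with
    | mem x hx =>
      obtain ⟨_, ⟨j, hj, rfl⟩, rfl⟩ := hx
      intro i
      simp only [baseChange_repr_one_tmul, Module.Basis.repr_self]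
      refine ⟨?_, fun hi => ?_⟩
      · rw [Finsupp.single_apply]; split_ifs <;> simp
      · rw [Finsupp.single_eq_of_ne (by rintro rfl; exact hi hj)]; simp
    | zero => simp
    | add x y _ _ hx hy =>
      intro i
      rw [map_add, Finsupp.add_apply]
      refine ⟨add_nonneg (hx i).1 (hy i).1, fun hi => ?_⟩
      rw [(hx i).2 hi, (hy i).2 hi, add_zero]
    | smul c x _ hx =>
      intro i
      have : (b.baseChange ℝ).repr (c • x) i = (c : ℝ) * (b.baseChange ℝ).repr x i := by
        change (b.baseChange ℝ).repr ((c : ℝ) • x) i = _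
        rw [map_smul, Finsupp.smul_apply, smul_eq_mul]
      rw [this]
      exact ⟨mul_nonneg c.2 (hx i).1, fun hi => by rw [(hx i).2 hi, mul_zero]⟩
  · intro h
    have := Fintype.ofFinite ι
    rw [← (b.baseChange ℝ).sum_repr x]
    refine Submodule.sum_mem _ fun i _ => ?_
    by_cases hi : i ∈ s
    · rw [Module.Basis.baseChange_apply]
      exact PointedCone.smul_mem _ (h i).1 (tmul_mem_cone (Set.mem_image_of_mem _ hi))
    · rw [(h i).2 hi, zero_smul]; exact zero_mem _

/-- The faces of a cone generated by a part of a basis are the cones generated by its subsets. -/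
lemma isFaceOf_cone_basis {s : Set ι} {τ : PointedCone ℝ (RealSpace N)} :
    τ.IsFaceOf (cone (b '' s)) ↔ ∃ t ⊆ s, τ = cone (b '' t) := by
  constructor
  · intro h
    refine ⟨{i ∈ s | (1 : ℝ) ⊗ₜ[ℤ] b i ∈ τ}, fun i hi => hi.1, le_antisymm ?_ ?_⟩
    · intro x hx
      have hxs := (mem_cone_basis b).1 (h.le hx)
      rw [mem_cone_basis]
      refine fun i => ⟨(hxs i).1, fun hi => ?_⟩
      by_cases his : i ∈ s
      · by_contra hne
        have hpos : 0 < (b.baseChange ℝ).repr x i := lt_of_le_of_ne (hxs i).1 (Ne.symm hne)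
        refine hi ⟨his, h.mem_of_smul_add_mem (y := x - (b.baseChange ℝ).repr x i •
          ((1 : ℝ) ⊗ₜ[ℤ] b i)) (tmul_mem_cone (Set.mem_image_of_mem _ his)) ?_ hpos (by simpa)⟩
        rw [mem_cone_basis]
        intro j
        rw [map_sub, map_smul, Finsupp.sub_apply, Finsupp.smul_apply, baseChange_repr_one_tmul,
          Module.Basis.repr_self]
        by_cases hji : j = i
        · subst hji; simp [his]
        · rw [Finsupp.single_eq_of_ne hji]; simpa using hxs j
      · exact (hxs i).2 his
    · rw [cone_le_iff]
      rintro _ ⟨i, hi, rfl⟩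
      exact hi.2
  · rintro ⟨t, hts, rfl⟩
    refine ⟨cone_mono (Set.image_mono hts), fun {x y a} hx hy ha hxy => ?_⟩
    rw [mem_cone_basis] at hx hy hxy ⊢
    refine fun i => ⟨(hx i).1, fun hi => ?_⟩
    have := (hxy i).2 hi
    rw [map_add, map_smul, Finsupp.add_apply, Finsupp.smul_apply, smul_eq_mul] at this
    have h1 := mul_nonneg ha.le (hx i).1
    have h2 : a * (b.baseChange ℝ).repr x i = 0 := by linarith [(hy i).1]
    exact (mul_eq_zero.1 h2).resolve_left ha.ne'

/-- Lattice points on the ray of a basis vector are its natural multiples. -/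
lemma exists_nsmul_of_mem_cone_singleton {i : ι} {y : N}
    (hy : (1 : ℝ) ⊗ₜ[ℤ] y ∈ cone ({b i} : Set N)) : ∃ k : ℕ, y = k • b i := by
  rw [← Set.image_singleton, mem_cone_basis] at hy
  simp only [baseChange_repr_one_tmul] at hy
  refine ⟨(b.repr y i).toNat, b.ext_elem fun j => ?_⟩
  have hj := hy j
  by_cases hji : j = i
  · subst hji
    have : 0 ≤ b.repr y j := by exact_mod_cast hj.1
    simp [this]
  · have : b.repr y j = 0 := by exact_mod_cast hj.2 hji
    rw [this]
    simp [Finsupp.single_eq_of_ne hji]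

/-- Rounding the coefficients of the multiples of a real combination of lattice points changes the
coordinates by a bounded amount. -/
lemma exists_floor_bound (S : Finset N) (c : N → ℝ) : ∃ C : ℕ, ∀ (k : ℕ) (i : ι),
    |(b.repr (∑ v ∈ S, ⌊k * c v⌋ • v) i : ℝ) -
      k * (b.baseChange ℝ).repr (∑ v ∈ S, c v • ((1 : ℝ) ⊗ₜ[ℤ] v)) i| ≤ C := by
  have := Fintype.ofFinite ι
  obtain ⟨C, hC⟩ := exists_nat_ge (∑ i, ∑ v ∈ S, |(b.repr v i : ℝ)|)
  refine ⟨C, fun k i => le_trans ?_ hC⟩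
  have h1 : (b.repr (∑ v ∈ S, ⌊k * c v⌋ • v) i : ℝ) -
      k * (b.baseChange ℝ).repr (∑ v ∈ S, c v • ((1 : ℝ) ⊗ₜ[ℤ] v)) i =
      ∑ v ∈ S, (⌊k * c v⌋ - k * c v) * (b.repr v i : ℝ) := by
    simp only [map_sum, map_smul, Finsupp.finsetSum_apply, Finsupp.smul_apply,
      baseChange_repr_one_tmul, smul_eq_mul, Int.cast_sum, Int.cast_mul, Finset.mul_sum,
      ← Finset.sum_sub_distrib]
    refine Finset.sum_congr rfl fun v _ => by ring
  rw [h1]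
  refine (Finset.abs_sum_le_sum_abs _ _).trans (le_trans (Finset.sum_le_sum fun v _ => ?_)
    (Finset.single_le_sum (f := fun i => ∑ v ∈ S, |(b.repr v i : ℝ)|)
      (fun i _ => Finset.sum_nonneg fun v _ => abs_nonneg _) (Finset.mem_univ i)))
  rw [abs_mul]
  refine mul_le_of_le_one_left (abs_nonneg _) (abs_le.2 ⟨?_, ?_⟩)
  · linarith [Int.lt_floor_add_one (k * c v)]
  · linarith [Int.floor_le (k * c v)]

end Basis

/-! ### The real fan of a complete nonsingular complex -/

/-- The fan of the cones generated by the members of a complex. -/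
def fanOf (K : Set (Finset N)) : Set (PointedCone ℝ (RealSpace N)) :=
  (fun S : Finset N => cone (S : Set N)) '' K

lemma coe_eq_image {M S : Finset N} (hS : S ⊆ M) (b : Module.Basis M ℤ N) (hb : ∀ v, b v = v) :
    (S : Set N) = b '' {i | (i : N) ∈ S} := by
  ext v
  constructor
  · intro hv
    exact ⟨⟨v, hS hv⟩, hv, hb _⟩
  · rintro ⟨i, hi, rfl⟩
    rw [hb]; exact hi

namespace IsLatticeFan

variable {K : Set (Finset N)} (hK : IsLatticeFan K)
include hK

lemma mem_cone_iff {M S : Finset N} (hM : IsFacet K M) (hS : S ⊆ M) {x : RealSpace N} :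
    x ∈ cone (S : Set N) ↔ ∀ i : M, 0 ≤ ((hK.basis hM).baseChange ℝ).repr x i ∧
      ((i : N) ∉ S → ((hK.basis hM).baseChange ℝ).repr x i = 0) := by
  rw [coe_eq_image hS (hK.basis hM) (hK.basis_apply hM), mem_cone_basis]
  rfl

lemma one_tmul_injective {y z : N} (h : (1 : ℝ) ⊗ₜ[ℤ] y = (1 : ℝ) ⊗ₜ[ℤ] z) : y = z := by
  obtain ⟨M, hM, -⟩ := hK.exists_facet hK.empty_mem
  exact ToricFan.one_tmul_injective (hK.basis hM) h

lemma exists_latticeSum_eq {M : Finset N} (hM : IsFacet K M) {y : N}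
    (hy : ∀ i, 0 ≤ (hK.basis hM).repr y i) : ∃ f : N →₀ ℕ, f.support ⊆ M ∧ latticeSum f = y := by
  refine ⟨∑ i : M, Finsupp.single (i : N) ((hK.basis hM).repr y i).toNat, fun v hv => ?_, ?_⟩
  · obtain ⟨i, -, hi⟩ := Finset.mem_biUnion.1 (Finsupp.support_finsetSum hv)
    have := Finsupp.support_single_subset hi
    rw [Finset.mem_singleton] at this
    exact this ▸ i.2
  · conv_rhs => rw [← (hK.basis hM).sum_repr y]
    rw [map_sum]
    refine Finset.sum_congr rfl fun i _ => ?_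
    rw [Finsupp.linearCombination_single, hK.basis_apply, ← natCast_zsmul,
      Int.toNat_of_nonneg (hy i)]
    rfl

/-- A point with positive coefficients on `S` lies in the cone of a facet only if the facet
contains `S`. Rounding reduces this to the uniqueness of the expressions of lattice points: two
comparable rounded multiples differ by a lattice point with positive coefficients on `S` that lies
in the cone of the facet. -/
lemma subset_facet {M S : Finset N} (hM : IsFacet K M) (hS : S ∈ K) {c : N → ℝ}
    (hc : ∀ v ∈ S, 0 < c v) (hx : ∑ v ∈ S, c v • ((1 : ℝ) ⊗ₜ[ℤ] v) ∈ cone (M : Set N)) :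
    S ⊆ M := by
  set x := ∑ v ∈ S, c v • ((1 : ℝ) ⊗ₜ[ℤ] v) with hxdef
  obtain ⟨C, hC⟩ := exists_floor_bound (hK.basis hM) S c
  rw [← hxdef] at hC
  obtain ⟨B, hB⟩ := exists_nat_ge (∑ v ∈ S, (c v)⁻¹)
  have hBc : ∀ v ∈ S, 1 ≤ B * c v := fun v hv => by
    have h1 : (c v)⁻¹ ≤ B := (Finset.single_le_sum (f := fun v => (c v)⁻¹)
      (fun w hw => (inv_pos.2 (hc w hw)).le) hv).trans hB
    have := mul_le_mul_of_nonneg_right h1 (hc v hv).le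
    rwa [inv_mul_cancel₀ (hc v hv).ne'] at this
  have hnn : ∀ i, 0 ≤ ((hK.basis hM).baseChange ℝ).repr x i := fun i =>
    ((hK.mem_cone_iff hM subset_rfl).1 hx i).1
  have hex : ∀ n : ℕ, ∃ h : N →₀ ℕ, h.support ⊆ M ∧
      latticeSum h = ∑ v ∈ S, ⌊((B * n : ℕ) : ℝ) * c v⌋ • v + C • ∑ v ∈ M, v := by
    intro n
    refine hK.exists_latticeSum_eq hM fun i => ?_
    have h1 := (abs_le.1 (hC (B * n) i)).1
    have h2 : (hK.basis hM).repr (∑ v ∈ M, v) i = 1 := by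
      rw [← Finset.sum_coe_sort M (fun v => v), map_sum, Finsupp.finsetSum_apply,
        Finset.sum_eq_single i]
      · have := (hK.basis hM).repr_self i
        rw [hK.basis_apply] at this
        rw [this]; simp
      · intro j _ hj
        have := (hK.basis hM).repr_self j
        rw [hK.basis_apply] at this
        rw [this, Finsupp.single_eq_of_ne hj.symm]
      · simp
    rw [map_add, map_nsmul, Finsupp.add_apply, Finsupp.smul_apply, h2]
    have h3 := mul_nonneg (Nat.cast_nonneg (α := ℝ) (B * n)) (hnn i)
    have h4 : (0 : ℝ) ≤
        ((hK.basis hM).repr (∑ v ∈ S, ⌊((B * n : ℕ) : ℝ) * c v⌋ • v) i : ℝ) + C := by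
      linarith
    have h5 : 0 ≤ (hK.basis hM).repr (∑ v ∈ S, ⌊((B * n : ℕ) : ℝ) * c v⌋ • v) i + C := by
      exact_mod_cast h4
    simpa using h5
  choose h hhM hh using hex
  obtain ⟨m, n, hmn, hle⟩ := hK.exists_lt_le h fun n => hK.down _ hM.1 _ (hhM n)
  have hpos : ∀ v ∈ S, ⌊((B * m : ℕ) : ℝ) * c v⌋ + 1 ≤ ⌊((B * n : ℕ) : ℝ) * c v⌋ := by
    intro v hv
    rw [Int.le_floor]
    push_cast
    have h1 := Int.floor_le (((B * m : ℕ) : ℝ) * c v)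
    push_cast at h1
    have h2 : (m : ℝ) + 1 ≤ n := by exact_mod_cast hmn
    nlinarith [hBc v hv]
  let G : N →₀ ℕ := ∑ v ∈ S, Finsupp.single v
    (⌊((B * n : ℕ) : ℝ) * c v⌋ - ⌊((B * m : ℕ) : ℝ) * c v⌋).toNat
  have hGapp : ∀ v, G v = if v ∈ S then
      (⌊((B * n : ℕ) : ℝ) * c v⌋ - ⌊((B * m : ℕ) : ℝ) * c v⌋).toNat else 0 := fun v => by
    simp only [G, Finsupp.finsetSum_apply, Finsupp.single_apply]
    simp
  have hGS : G.support = S := by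
    ext v
    rw [Finsupp.mem_support_iff, hGapp]
    split_ifs with hv
    · have := hpos v hv
      simp only [hv, iff_true]; omega
    · simp [hv]
  have hsub : (h n - h m).support ⊆ M := fun v hv => hhM n (by
    simp only [Finsupp.mem_support_iff, Finsupp.tsub_apply] at hv ⊢; omega)
  have heq := hK.inj G (h n - h m) (hGS ▸ hS) (hK.down _ hM.1 _ hsub) (by
    have h1 : latticeSum (h n - h m) + latticeSum (h m) = latticeSum (h n) := by
      rw [← map_add, tsub_add_cancel_of_le hle]
    rw [hh, hh, ← add_assoc] at h1
    have h2 := add_right_cancel h1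
    rw [← add_right_cancel_iff (a := ∑ v ∈ S, ⌊((B * m : ℕ) : ℝ) * c v⌋ • v), h2]
    simp only [G, map_sum, Finsupp.linearCombination_single, id]
    rw [← Finset.sum_add_distrib]
    refine Finset.sum_congr rfl fun v hv => ?_
    rw [← natCast_zsmul, Int.toNat_of_nonneg (by have := hpos v hv; omega), ← add_smul]
    congr 1; omega)
  rw [← hGS, heq]
  exact hsub

lemma exists_pos_coeff {S : Finset N} (hS : S ∈ K) {x : RealSpace N}
    (hx : x ∈ cone (S : Set N)) : ∃ A ⊆ S, ∃ c : N → ℝ, A ∈ K ∧ (∀ v ∈ A, 0 < c v) ∧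
      ∑ v ∈ A, c v • ((1 : ℝ) ⊗ₜ[ℤ] v) = x := by
  obtain ⟨c, h0, hc⟩ := mem_cone_finset.1 hx
  refine ⟨S.filter fun v => 0 < c v, Finset.filter_subset _ _, c,
    hK.down _ hS _ (Finset.filter_subset _ _), fun v hv => (Finset.mem_filter.1 hv).2, ?_⟩
  rw [← hc]
  refine Finset.sum_subset (Finset.filter_subset _ _) fun v hv hvn => ?_
  have : c v = 0 := le_antisymm (not_lt.1 fun h => hvn (Finset.mem_filter.2 ⟨hv, h⟩)) (h0 v)
  rw [this, zero_smul]

lemma repr_sum {M A : Finset N} (hM : IsFacet K M) (hA : A ⊆ M) (c : N → ℝ) (i : M) :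
    ((hK.basis hM).baseChange ℝ).repr (∑ v ∈ A, c v • ((1 : ℝ) ⊗ₜ[ℤ] v)) i =
      if (i : N) ∈ A then c i else 0 := by
  have hb : ∀ v (hv : v ∈ M), (hK.basis hM).repr v = Finsupp.single ⟨v, hv⟩ 1 := fun v hv => by
    have := (hK.basis hM).repr_self ⟨v, hv⟩
    rwa [hK.basis_apply] at this
  rw [map_sum, Finsupp.finsetSum_apply]
  simp only [map_smul, Finsupp.smul_apply, baseChange_repr_one_tmul, smul_eq_mul]
  split_ifs with hi
  · rw [Finset.sum_eq_single (i : N)]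
    · rw [hb i i.2]; simp
    · intro v hv hvi
      rw [hb v (hA hv), Finsupp.single_eq_of_ne (fun h => hvi (by rw [h]))]; simp
    · exact fun h => absurd hi h
  · refine Finset.sum_eq_zero fun v hv => ?_
    rw [hb v (hA hv), Finsupp.single_eq_of_ne (fun h => hi (by rw [h]; exact hv))]; simp

/-- A point with positive coefficients on `A` lies in the cone of `S` only if `A ⊆ S`. -/
lemma subset_of_mem_cone {A S : Finset N} (hA : A ∈ K) (hS : S ∈ K) {c : N → ℝ}
    (hc : ∀ v ∈ A, 0 < c v) (hx : ∑ v ∈ A, c v • ((1 : ℝ) ⊗ₜ[ℤ] v) ∈ cone (S : Set N)) :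
    A ⊆ S := by
  obtain ⟨M, hM, hSM⟩ := hK.exists_facet hS
  have hAM := hK.subset_facet hM hA hc (cone_mono (Finset.coe_subset.2 hSM) hx)
  intro v hv
  by_contra hvS
  have := ((hK.mem_cone_iff hM hSM).1 hx ⟨v, hAM hv⟩).2 hvS
  rw [hK.repr_sum hM hAM, if_pos hv] at this
  exact (hc v hv).ne' this

lemma mem_of_tmul_mem {S : Finset N} (hS : S ∈ K) {v : N} (hv : {v} ∈ K)
    (h : (1 : ℝ) ⊗ₜ[ℤ] v ∈ cone (S : Set N)) : v ∈ S := by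
  have := hK.subset_of_mem_cone hv hS (c := fun _ => 1) (fun _ _ => zero_lt_one) (by simpa using h)
  simpa using this

lemma cone_le_cone_iff {A S : Finset N} (hA : ∀ v ∈ A, {v} ∈ K) (hS : S ∈ K) :
    cone (A : Set N) ≤ cone (S : Set N) ↔ A ⊆ S := by
  refine ⟨fun h v hv => ?_, fun h => cone_mono (Finset.coe_subset.2 h)⟩
  exact hK.mem_of_tmul_mem hS (hA v hv) (h (tmul_mem_cone hv))

lemma cone_mem_iff {S : Finset N} (hS : ∀ v ∈ S, {v} ∈ K) : cone (S : Set N) ∈ fanOf K ↔ S ∈ K := by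
  refine ⟨?_, fun h => ⟨S, h, rfl⟩⟩
  rintro ⟨A, hA, h⟩
  exact hK.down _ hA _ ((hK.cone_le_cone_iff hS hA).1 h.ge)

lemma inf_cone {A S : Finset N} (hA : A ∈ K) (hS : S ∈ K) :
    cone (A : Set N) ⊓ cone (S : Set N) = cone ((A ∩ S : Finset N) : Set N) := by
  refine le_antisymm ?_ (le_inf (cone_mono (Finset.coe_subset.2 Finset.inter_subset_left))
    (cone_mono (Finset.coe_subset.2 Finset.inter_subset_right)))
  rintro x ⟨hxA, hxS⟩
  obtain ⟨B, hBA, c, hB, hc, rfl⟩ := hK.exists_pos_coeff hA hxA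
  have hBS := hK.subset_of_mem_cone hB hS hc hxS
  exact cone_mono (Finset.coe_subset.2 (Finset.subset_inter hBA hBS))
    (sum_mem_cone fun v hv => (hc v hv).le)

lemma isFaceOf_iff {S : Finset N} (hS : S ∈ K) {τ : PointedCone ℝ (RealSpace N)} :
    τ.IsFaceOf (cone (S : Set N)) ↔ ∃ A ⊆ S, τ = cone (A : Set N) := by
  obtain ⟨M, hM, hSM⟩ := hK.exists_facet hS
  have hb := hK.basis_apply hM
  rw [coe_eq_image hSM (hK.basis hM) hb, isFaceOf_cone_basis]
  constructor
  · rintro ⟨t, ht, rfl⟩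
    refine ⟨S.filter fun v => ∃ h : v ∈ M, ⟨v, h⟩ ∈ t, Finset.filter_subset _ _, ?_⟩
    congr 1
    ext v
    simp only [Set.mem_image, Finset.coe_filter, Set.mem_ofPred_eq]
    constructor
    · rintro ⟨i, hi, rfl⟩
      rw [hb]
      exact ⟨ht hi, i.2, hi⟩
    · rintro ⟨-, h, hi⟩
      exact ⟨_, hi, hb _⟩
  · rintro ⟨A, hA, rfl⟩
    refine ⟨{i | (i : N) ∈ A}, fun i hi => hA hi, ?_⟩
    rw [coe_eq_image (hA.trans hSM) (hK.basis hM) hb]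

theorem isFan : IsFan (fanOf K) where
  finite := hK.finite.image _
  nonempty := ⟨_, ∅, hK.empty_mem, rfl⟩
  rational := by
    rintro _ ⟨S, -, rfl⟩
    exact ⟨S, rfl⟩
  stronglyConvex := by
    rintro _ ⟨S, hS, rfl⟩ x hx hx'
    obtain ⟨M, hM, hSM⟩ := hK.exists_facet hS
    have h1 := (hK.mem_cone_iff hM hSM).1 hx
    have h2 := (hK.mem_cone_iff hM hSM).1 hx'
    refine ((hK.basis hM).baseChange ℝ).ext_elem fun i => ?_
    have h3 := (h2 i).1
    rw [map_neg, Finsupp.neg_apply] at h3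
    rw [map_zero, Finsupp.zero_apply]
    linarith [(h1 i).1]
  face_mem := by
    rintro _ ⟨S, hS, rfl⟩ τ hτ
    obtain ⟨A, hA, rfl⟩ := (hK.isFaceOf_iff hS).1 hτ
    exact ⟨A, hK.down _ hS _ hA, rfl⟩
  inter_face := by
    rintro _ ⟨S, hS, rfl⟩ _ ⟨T, hT, rfl⟩
    exact (hK.isFaceOf_iff hS).2 ⟨S ∩ T, Finset.inter_subset_left, hK.inf_cone hS hT⟩

theorem isNonsingular : IsNonsingular (fanOf K) := by
  rintro _ ⟨S, hS, rfl⟩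
  obtain ⟨M, hM, hSM⟩ := hK.exists_facet hS
  have hb := hK.basis_apply hM
  have hcard : Fintype.card M = Module.finrank ℤ N :=
    (Module.finrank_eq_card_basis (hK.basis hM)).symm
  refine ⟨(hK.basis hM).reindex (Fintype.equivFinOfCardEq hcard),
    {i | (((Fintype.equivFinOfCardEq hcard).symm i : M) : N) ∈ S}, ?_⟩
  change cone (S : Set N) = _
  congr 1
  rw [coe_eq_image hSM (hK.basis hM) hb]
  ext v
  constructor
  · rintro ⟨i, hi, rfl⟩
    exact ⟨Fintype.equivFinOfCardEq hcard i, by simpa using hi, by simp⟩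
  · rintro ⟨i, hi, rfl⟩
    exact ⟨(Fintype.equivFinOfCardEq hcard).symm i, hi, by simp⟩

/-- The cones cover the real space: infinitely many rounded multiples of a given point lie in the
cone of one facet, and their coordinates bound those of the point from below. -/
theorem isComplete : IsComplete (fanOf K) := by
  intro x
  obtain ⟨M₀, hM₀, -⟩ := hK.exists_facet hK.empty_mem
  obtain ⟨c, hx⟩ : ∃ c : N → ℝ, ∑ v ∈ M₀, c v • ((1 : ℝ) ⊗ₜ[ℤ] v) = x := by
    refine ⟨fun v => if h : v ∈ M₀ then ((hK.basis hM₀).baseChange ℝ).repr x ⟨v, h⟩ else 0, ?_⟩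
    conv_rhs => rw [← ((hK.basis hM₀).baseChange ℝ).sum_repr x]
    rw [← Finset.sum_coe_sort]
    refine Finset.sum_congr rfl fun i _ => ?_
    dsimp only
    rw [dif_pos i.2, Module.Basis.baseChange_apply, hK.basis_apply]
  have hex : ∀ k : ℕ, ∃ M : Finset N, IsFacet K M ∧ ∃ f : N →₀ ℕ, f.support ⊆ M ∧
      latticeSum f = ∑ v ∈ M₀, ⌊k * c v⌋ • v := fun k => by
    obtain ⟨f, hf, hfx⟩ := hK.surj (∑ v ∈ M₀, ⌊k * c v⌋ • v)
    obtain ⟨M, hM, hfM⟩ := hK.exists_facet hf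
    exact ⟨M, hM, f, hfM, hfx⟩
  choose F hF f hfF hf using hex
  have : Finite K := hK.finite
  obtain ⟨⟨M, hMK⟩, hM'⟩ := Finite.exists_infinite_fiber fun k => (⟨F k, (hF k).1⟩ : K)
  have hinf : {k | F k = M}.Infinite := by
    rw [← Set.infinite_coe_iff]
    convert hM' using 2
    ext k; simp
  obtain ⟨k₀, hk₀⟩ := hinf.nonempty
  have hM : IsFacet K M := hk₀ ▸ hF k₀
  refine ⟨_, ⟨M, hMK, rfl⟩, (hK.mem_cone_iff hM subset_rfl).2 fun i => ⟨?_, fun h => absurd i.2 h⟩⟩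
  obtain ⟨C, hC⟩ := exists_floor_bound (hK.basis hM) M₀ c
  rw [hx] at hC
  by_contra! hneg
  obtain ⟨n, hn⟩ := exists_nat_gt (C / -((hK.basis hM).baseChange ℝ).repr x i)
  obtain ⟨k, hk, hnk⟩ := hinf.exists_gt n
  have hkM : F k = M := hk
  have h1 : 0 ≤ (hK.basis hM).repr (∑ v ∈ M₀, ⌊k * c v⌋ • v) i := by
    rw [← hf k, Finsupp.linearCombination_apply, Finsupp.sum, map_sum, Finsupp.finsetSum_apply]
    refine Finset.sum_nonneg fun v hv => ?_
    have hvM : v ∈ M := hkM ▸ hfF k hv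
    have := (hK.basis hM).repr_self ⟨v, hvM⟩
    rw [hK.basis_apply] at this
    rw [map_nsmul, id, this, Finsupp.smul_apply, Finsupp.single_apply]
    split_ifs <;> simp
  have h2 := (abs_le.1 (hC k i)).2
  have h3 : (0 : ℝ) ≤ (hK.basis hM).repr (∑ v ∈ M₀, ⌊k * c v⌋ • v) i := by exact_mod_cast h1
  have h4 : (n : ℝ) < k := by exact_mod_cast hnk
  rw [div_lt_iff₀ (by linarith)] at hn
  nlinarith

theorem isRayGenerator_iff {v : N} : IsRayGenerator (fanOf K) v ↔ {v} ∈ K := by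
  constructor
  · rintro ⟨hv0, ⟨S, hS, hSv⟩, hv⟩
    obtain ⟨M, hM, hSM⟩ := hK.exists_facet hS
    have hmul : ∀ s ∈ S, ∃ k : ℕ, s = k • v := fun s hs => hv s (by
      rw [← hSv]; exact tmul_mem_cone hs)
    have hvS : (1 : ℝ) ⊗ₜ[ℤ] v ∈ cone (S : Set N) := by
      change cone (S : Set N) = _ at hSv
      rw [hSv]; exact tmul_mem_cone rfl
    obtain ⟨A, hAS, c, hA, hc, hsum⟩ := hK.exists_pos_coeff hS hvS
    obtain ⟨s, hs⟩ : S.Nonempty := by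
      rw [Finset.nonempty_iff_ne_empty]
      rintro rfl
      obtain rfl := Finset.subset_empty.1 hAS
      exact hv0 (hK.one_tmul_injective (by rw [← hsum]; simp))
    obtain ⟨k, hk⟩ := hmul s hs
    have hk0 : k ≠ 0 := by
      rintro rfl
      exact hK.ne_zero (hK.singleton_mem hS hs) (by rw [hk, zero_smul])
    -- every element of `S` is a multiple of `v`, so there is only one
    have hone : ∀ t ∈ S, t = s := fun t ht => by
      obtain ⟨j, hj⟩ := hmul t ht
      have h := hK.inj (Finsupp.single t k) (Finsupp.single s j)
        (hK.down _ (hK.singleton_mem hS ht) _ Finsupp.support_single_subset)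
        (hK.down _ (hK.singleton_mem hS hs) _ Finsupp.support_single_subset) (by
          rw [Finsupp.linearCombination_single, Finsupp.linearCombination_single, id, id, hj, hk,
            smul_smul, smul_smul, mul_comm])
      by_contra hts
      have := DFunLike.congr_fun h t
      rw [Finsupp.single_eq_same, Finsupp.single_eq_of_ne hts] at this
      exact hk0 this
    have hS1 : S = {s} := Finset.eq_singleton_iff_unique_mem.2 ⟨hs, hone⟩
    have hvs : ∃ j : ℕ, v = j • s := by
      have := exists_nsmul_of_mem_cone_singleton (hK.basis hM) (i := ⟨s, hSM hs⟩) (y := v) (by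
        rw [hK.basis_apply]
        rw [hS1, Finset.coe_singleton] at hvS
        exact hvS)
      rwa [hK.basis_apply] at this
    obtain ⟨j, hj⟩ := hvs
    have h := hK.inj (Finsupp.single s 1) (Finsupp.single s (k * j))
      (hK.down _ (hK.singleton_mem hS hs) _ Finsupp.support_single_subset)
      (hK.down _ (hK.singleton_mem hS hs) _ Finsupp.support_single_subset) (by
        rw [Finsupp.linearCombination_single, Finsupp.linearCombination_single, id, one_smul,
          mul_smul, ← hj, ← hk])
    have hkj := DFunLike.congr_fun h s
    simp only [Finsupp.single_eq_same] at hkj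
    have : k = 1 := Nat.eq_one_of_mul_eq_one_right hkj.symm
    rw [this, one_smul] at hk
    rw [← hk, ← hS1]; exact hS
  · intro hv
    obtain ⟨M, hM, hvM⟩ := hK.exists_facet hv
    rw [Finset.singleton_subset_iff] at hvM
    refine ⟨hK.ne_zero hv, ⟨{v}, hv, by simp⟩, fun y hy => ?_⟩
    have := exists_nsmul_of_mem_cone_singleton (hK.basis hM) (i := ⟨v, hvM⟩) (y := y)
      (by rwa [hK.basis_apply])
    rwa [hK.basis_apply] at this

lemma eq_of_fanOf_eq {K' : Set (Finset N)} (hK' : IsLatticeFan K') (h : fanOf K = fanOf K') :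
    K = K' := by
  have hv : ∀ v, {v} ∈ K ↔ {v} ∈ K' := fun v => by
    rw [← hK.isRayGenerator_iff, h, hK'.isRayGenerator_iff]
  ext S
  constructor
  · intro hS
    exact (hK'.cone_mem_iff fun v hw => (hv v).1 (hK.singleton_mem hS hw)).1 (h ▸ ⟨S, hS, rfl⟩)
  · intro hS
    exact (hK.cone_mem_iff fun v hw => (hv v).2 (hK'.singleton_mem hS hw)).1 (h ▸ ⟨S, hS, rfl⟩)

end IsLatticeFan

end RealCones

section FromReal

variable {N : Type*} [AddCommGroup N]

/-- The generators of a cone spanned by a part of a basis are determined by the cone. -/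
lemma image_subset_of_cone_eq {ι κ : Type*} [Finite ι] [Finite κ] (b : Module.Basis ι ℤ N)
    (c : Module.Basis κ ℤ N) {s : Set ι} {t : Set κ} (h : cone (b '' s) = cone (c '' t)) :
    b '' s ⊆ c '' t := by
  rintro _ ⟨i, hi, rfl⟩
  have hface : (cone ({b i} : Set N)).IsFaceOf (cone (c '' t)) := by
    rw [← h, ← Set.image_singleton, isFaceOf_cone_basis]
    exact ⟨{i}, by simpa using hi, rfl⟩
  obtain ⟨t', ht', htc⟩ := (isFaceOf_cone_basis c).1 hface
  obtain ⟨j, hj⟩ : t'.Nonempty := by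
    rw [Set.nonempty_iff_ne_empty]
    rintro rfl
    have h1 : (1 : ℝ) ⊗ₜ[ℤ] b i ∈ cone (b '' (∅ : Set ι)) := by
      have := tmul_mem_cone (Set.mem_singleton (b i))
      rw [htc, Set.image_empty] at this
      rwa [Set.image_empty]
    have := ((mem_cone_basis b).1 h1 i).2 (Set.notMem_empty i)
    simp at this
  obtain ⟨n, hn⟩ := exists_nsmul_of_mem_cone_singleton b (i := i) (y := c j) (by
    rw [htc]; exact tmul_mem_cone ⟨j, hj, rfl⟩)
  have h1 : (1 : ℤ) = n * c.repr (b i) j := by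
    have := congrArg (fun y => c.repr y j) hn
    simpa using this
  have hn1 : n = 1 := by
    have : (n : ℤ) ∣ 1 := ⟨_, h1⟩
    have := Int.natAbs_dvd_natAbs.2 this
    simpa using this
  exact ⟨j, ht' hj, by rw [hn, hn1, one_smul]⟩

/-- Every complete nonsingular fan comes from a complete nonsingular complex of lattice points. -/
theorem exists_isLatticeFan {Δ : Set (PointedCone ℝ (RealSpace N))} (hfan : IsFan Δ)
    (hcomplete : IsComplete Δ) (hnonsing : IsNonsingular Δ) :
    ∃ K : Set (Finset N), IsLatticeFan K ∧ Δ = fanOf K := by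
  let K : Set (Finset N) := {S | cone (S : Set N) ∈ Δ ∧
    ∃ (b : Module.Basis (Fin (Module.finrank ℤ N)) ℤ N) (s : Set (Fin (Module.finrank ℤ N))),
      (S : Set N) = b '' s}
  have hΔ : ∀ σ ∈ Δ, ∃ S ∈ K, σ = cone (S : Set N) := by
    intro σ hσ
    obtain ⟨b, s, rfl⟩ := hnonsing σ hσ
    have hf : (b '' s).Finite := (Set.toFinite s).image b
    refine ⟨hf.toFinset, ⟨by simpa using hσ, b, s, by simp⟩, by simp⟩
  have hinj : ∀ S ∈ K, ∀ T ∈ K, cone (S : Set N) = cone (T : Set N) → S = T := by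
    rintro S ⟨-, b, s, hS⟩ T ⟨-, c, t, hT⟩ h
    rw [← Finset.coe_inj]
    rw [hS, hT] at h ⊢
    exact (image_subset_of_cone_eq b c h).antisymm (image_subset_of_cone_eq c b h.symm)
  have hdown : ∀ S ∈ K, ∀ T, T ⊆ S → T ∈ K := by
    rintro S ⟨hS, b, s, hb⟩ T hT
    have hTb : (T : Set N) = b '' {i ∈ s | b i ∈ T} := by
      ext v
      constructor
      · intro hv
        obtain ⟨i, hi, rfl⟩ : v ∈ b '' s := hb ▸ Finset.mem_coe.2 (hT hv)
        exact ⟨i, ⟨hi, hv⟩, rfl⟩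
      · rintro ⟨i, hi, rfl⟩; exact hi.2
    refine ⟨hfan.face_mem _ hS _ ?_, b, _, hTb⟩
    rw [hb, isFaceOf_cone_basis]
    exact ⟨{i ∈ s | b i ∈ T}, fun i hi => hi.1, by rw [hTb]⟩
  refine ⟨K, ⟨?_, hdown, ?_, ?_⟩, ?_⟩
  · refine Set.Finite.of_finite_image (f := fun S : Finset N => cone (S : Set N))
      (hfan.finite.subset ?_) fun S hS T hT h => hinj S hS T hT h
    rintro _ ⟨S, hS, rfl⟩
    exact hS.1
  · -- the common point of the two cones is interior to both, so the cones are equal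
    have key : ∀ f g : N →₀ ℕ, f.support ∈ K → g.support ∈ K → latticeSum f = latticeSum g →
        cone (f.support : Set N) ≤ cone (g.support : Set N) := by
      rintro f g ⟨hf, b, s, hb⟩ ⟨hg, -⟩ hfg
      have hmem : ∀ f : N →₀ ℕ, (1 : ℝ) ⊗ₜ[ℤ] (latticeSum f) ∈ cone (f.support : Set N) := by
        intro f
        have h : (1 : ℝ) ⊗ₜ[ℤ] (latticeSum f) =
            ∑ v ∈ f.support, (f v : ℝ) • ((1 : ℝ) ⊗ₜ[ℤ] v) := by
          rw [Finsupp.linearCombination_apply, Finsupp.sum, TensorProduct.tmul_sum]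
          refine Finset.sum_congr rfl fun v _ => ?_
          rw [id, TensorProduct.tmul_smul, Nat.cast_smul_eq_nsmul]
        rw [h]
        exact sum_mem_cone fun v _ => Nat.cast_nonneg _
      have hface := hfan.inter_face _ hf _ hg
      rw [cone_le_iff]
      intro v hv
      have hle : Finsupp.single v 1 ≤ f := by
        rw [Finsupp.single_le_iff]
        exact Nat.one_le_iff_ne_zero.2 (Finsupp.mem_support_iff.1 hv)
      have hsub : (f - Finsupp.single v 1).support ⊆ f.support := fun w hw => by
        simp only [Finsupp.mem_support_iff, Finsupp.tsub_apply] at hw ⊢; omega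
      have hsum : (1 : ℝ) ⊗ₜ[ℤ] v + (1 : ℝ) ⊗ₜ[ℤ] (latticeSum (f - Finsupp.single v 1)) =
          (1 : ℝ) ⊗ₜ[ℤ] (latticeSum f) := by
        rw [← TensorProduct.tmul_add]
        congr 1
        conv_rhs => rw [← add_tsub_cancel_of_le hle, map_add, Finsupp.linearCombination_single]
        simp
      have := hface.mem_of_add_mem_left (tmul_mem_cone hv)
        (cone_mono (Finset.coe_subset.2 hsub) (hmem _)) (by
          rw [hsum]
          exact ⟨hmem f, by rw [hfg]; exact hmem g⟩)
      exact this.2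
    intro f g hf hg hfg
    have hsupp := hinj _ hf _ hg ((key f g hf hg hfg).antisymm (key g f hg hf hfg.symm))
    obtain ⟨-, b, s, hb⟩ := hf
    have hcoord : ∀ f : N →₀ ℕ, (f.support : Set N) = b '' s → ∀ i ∈ s,
        b.repr (latticeSum f) i = f (b i) := by
      intro f hf i hi
      rw [Finsupp.linearCombination_apply, Finsupp.sum, map_sum, Finsupp.finsetSum_apply,
        Finset.sum_eq_single (b i)]
      · simp
      · intro v hv hne
        obtain ⟨j, -, rfl⟩ := hf ▸ (Finset.mem_coe.2 hv)
        have hij : i ≠ j := fun h => hne (by rw [h])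
        simp [Finsupp.single_eq_of_ne hij]
      · intro hn
        exact absurd (show b i ∈ (f.support : Set N) from hf ▸ ⟨i, hi, rfl⟩) hn
    ext v
    by_cases hv : v ∈ f.support
    · obtain ⟨i, hi, rfl⟩ := hb ▸ (Finset.mem_coe.2 hv)
      have h1 := hcoord f hb i hi
      rw [hfg, hcoord g (hsupp ▸ hb) i hi] at h1
      exact_mod_cast h1.symm
    · rw [Finsupp.notMem_support_iff.1 hv, Finsupp.notMem_support_iff.1 (hsupp ▸ hv)]
  · intro x
    obtain ⟨σ, hσ, hx⟩ := hcomplete ((1 : ℝ) ⊗ₜ[ℤ] x)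
    obtain ⟨b, s, rfl⟩ := hnonsing σ hσ
    rw [mem_cone_basis] at hx
    simp only [baseChange_repr_one_tmul] at hx
    have hfin : (b '' s).Finite := (Set.toFinite s).image b
    refine ⟨∑ i, Finsupp.single (b i) (b.repr x i).toNat,
      hdown hfin.toFinset ⟨by simpa using hσ, b, s, by simp⟩ _ fun v hv => ?_, ?_⟩
    · obtain ⟨i, -, hi⟩ := Finset.mem_biUnion.1 (Finsupp.support_finsetSum hv)
      have hv' := Finsupp.support_single_subset hi
      rw [Finset.mem_singleton] at hv'
      rw [Set.Finite.mem_toFinset]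
      refine ⟨i, ?_, hv'.symm⟩
      by_contra his
      have h0 : b.repr x i = 0 := by exact_mod_cast (hx i).2 his
      rw [h0] at hi
      simp at hi
    · conv_rhs => rw [← b.sum_repr x]
      rw [map_sum]
      refine Finset.sum_congr rfl fun i _ => ?_
      have h0 : 0 ≤ b.repr x i := by exact_mod_cast (hx i).1
      rw [Finsupp.linearCombination_single, ← natCast_zsmul, Int.toNat_of_nonneg h0]
      rfl
  · ext σ
    constructor
    · intro hσ
      obtain ⟨S, hS, rfl⟩ := hΔ σ hσ
      exact ⟨S, hS, rfl⟩
    · rintro ⟨S, hS, rfl⟩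
      exact hS.1

/-! ### Ampleness on the real fan -/

namespace IsLatticeFan

variable {K : Set (Finset N)} (hK : IsLatticeFan K)
include hK

lemma span_cone_facet {M : Finset N} (hM : IsFacet K M) :
    Submodule.span ℝ (cone (M : Set N) : Set (RealSpace N)) = ⊤ := by
  rw [eq_top_iff, ← ((hK.basis hM).baseChange ℝ).span_eq, Submodule.span_le]
  rintro _ ⟨i, rfl⟩
  rw [Module.Basis.baseChange_apply, hK.basis_apply]
  exact Submodule.subset_span (tmul_mem_cone i.2)

lemma isFacet_of_span_eq_top {S : Finset N} (hS : S ∈ K)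
    (h : Submodule.span ℝ (cone (S : Set N) : Set (RealSpace N)) = ⊤) : IsFacet K S := by
  obtain ⟨M, hM, hSM⟩ := hK.exists_facet hS
  suffices hMS : M ⊆ S by rwa [hSM.antisymm hMS]
  intro v hv
  by_contra hvS
  -- the coordinate of `v` vanishes on the cone of `S`, but not everywhere
  have h1 : Submodule.span ℝ (cone (S : Set N) : Set (RealSpace N)) ≤
      LinearMap.ker (((hK.basis hM).baseChange ℝ).coord ⟨v, hv⟩) :=
    Submodule.span_le.2 fun x hx => ((hK.mem_cone_iff hM hSM).1 hx ⟨v, hv⟩).2 hvS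
  rw [h] at h1
  have h2 := h1 (Submodule.mem_top (x := (hK.basis hM).baseChange ℝ ⟨v, hv⟩))
  rw [LinearMap.mem_ker, Module.Basis.coord_apply, Module.Basis.repr_self] at h2
  simp at h2

/-- The anticanonical divisor is ample in terms of real piecewise linear functions if and only if
it is in terms of the linear forms of the facets. -/
theorem isFano_iff : IsFano (fanOf K) ↔ IsStarFano K ∅ := by
  constructor
  · rintro ⟨ψ, hlin, hray, hconv⟩ M hM - ℓ - h1 w hw hwM
    replace hw : {w} ∈ K := by simpa using hw
    obtain ⟨u, hu⟩ := hlin _ ⟨M, hM.1, rfl⟩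
    have hlt := hconv _ ⟨M, hM.1, rfl⟩ (hK.span_cone_facet hM) u hu ((1 : ℝ) ⊗ₜ[ℤ] w)
      fun h => hwM (hK.mem_of_tmul_mem hM.1 hw h)
    rw [hray w (hK.isRayGenerator_iff.2 hw)] at hlt
    have huℓ : ∀ y : N, u ((1 : ℝ) ⊗ₜ[ℤ] y) = -(ℓ y : ℝ) := by
      intro y
      have hy := (hK.basis hM).sum_repr y
      rw [← hy, TensorProduct.tmul_sum, map_sum, map_sum, Int.cast_sum, ← Finset.sum_neg_distrib]
      refine Finset.sum_congr rfl fun i _ => ?_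
      have h2 : u ((1 : ℝ) ⊗ₜ[ℤ] (i : N)) = -1 := by
        rw [← hu _ (tmul_mem_cone i.2),
          hray i (hK.isRayGenerator_iff.2 (hK.singleton_mem hM.1 i.2))]
        simp
      rw [hK.basis_apply, TensorProduct.tmul_smul, map_zsmul, map_zsmul, h2,
        h1 i i.2 (Finset.notMem_empty _)]
      simp
    rw [huℓ] at hlt
    have : (ℓ w : ℝ) < 1 := by push_cast at hlt; linarith
    have : ℓ w < 1 := by exact_mod_cast this
    omega
  · intro hF
    -- the linear form of each facet
    have hu : ∀ M, IsFacet K M → ∃ u : Module.Dual ℝ (RealSpace N),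
        (∀ v ∈ M, u ((1 : ℝ) ⊗ₜ[ℤ] v) = -1) := fun M hM => by
      refine ⟨((hK.basis hM).baseChange ℝ).constr ℝ fun _ => -1, fun v hv => ?_⟩
      have := ((hK.basis hM).baseChange ℝ).constr_basis ℝ (fun _ => (-1 : ℝ)) ⟨v, hv⟩
      rwa [Module.Basis.baseChange_apply, hK.basis_apply] at this
    choose! u hu using hu
    have hcov : ∀ x : RealSpace N, ∃ M, IsFacet K M ∧ x ∈ cone (M : Set N) := fun x => by
      obtain ⟨_, ⟨S, hS, rfl⟩, hx⟩ := hK.isComplete x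
      obtain ⟨M, hM, hSM⟩ := hK.exists_facet hS
      exact ⟨M, hM, cone_mono (Finset.coe_subset.2 hSM) hx⟩
    choose F hF1 hF2 using hcov
    have hagree' : ∀ M M', IsFacet K M → IsFacet K M' → ∀ x ∈ cone (M : Set N),
        x ∈ cone (M' : Set N) → u M' x = u M x := by
      intro M M' hM hM' x hx hx'
      have h : x ∈ cone ((M ∩ M' : Finset N) : Set N) := by
        rw [← hK.inf_cone hM.1 hM'.1]; exact ⟨hx, hx'⟩
      obtain ⟨c, -, rfl⟩ := mem_cone_finset.1 h
      rw [map_sum, map_sum]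
      refine Finset.sum_congr rfl fun v hv => ?_
      have hv' := Finset.mem_inter.1 hv
      rw [map_smul, map_smul, hu M hM v hv'.1, hu M' hM' v hv'.2]
    have hagree : ∀ M, IsFacet K M → ∀ x ∈ cone (M : Set N), u (F x) x = u M x :=
      fun M hM x hx => hagree' M _ hM (hF1 x) x hx (hF2 x)
    refine ⟨fun x => u (F x) x, ?_, ?_, ?_⟩
    · rintro _ ⟨S, hS, rfl⟩
      obtain ⟨M, hM, hSM⟩ := hK.exists_facet hS
      exact ⟨u M, fun x hx => hagree M hM x (cone_mono (Finset.coe_subset.2 hSM) hx)⟩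
    · intro ρ hρ
      obtain ⟨M, hM, hρM⟩ := hK.exists_facet (hK.isRayGenerator_iff.1 hρ)
      rw [Finset.singleton_subset_iff] at hρM
      change u (F _) _ = _
      rw [hagree M hM _ (tmul_mem_cone hρM), hu M hM ρ hρM]
      simp
    · rintro _ ⟨S, hS, rfl⟩ hspan u' hu' x hx
      have hM := hK.isFacet_of_span_eq_top hS hspan
      have hu'v : ∀ v ∈ S, u' ((1 : ℝ) ⊗ₜ[ℤ] v) = -1 := fun v hv => by
        rw [← hu' _ (tmul_mem_cone hv)]
        change u (F _) _ = _
        rw [hagree S hM _ (tmul_mem_cone hv), hu S hM v hv]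
      obtain ⟨ℓ, hℓ⟩ := hK.exists_dual hM fun _ => 1
      have hu'ℓ : ∀ y : N, u' ((1 : ℝ) ⊗ₜ[ℤ] y) = -(ℓ y : ℝ) := by
        intro y
        have hy := (hK.basis hM).sum_repr y
        rw [← hy, TensorProduct.tmul_sum, map_sum, map_sum, Int.cast_sum, ← Finset.sum_neg_distrib]
        refine Finset.sum_congr rfl fun i _ => ?_
        rw [hK.basis_apply, TensorProduct.tmul_smul, map_zsmul, map_zsmul, hu'v i i.2, hℓ i i.2]
        simp
      have hout : ∀ v, {v} ∈ K → v ∉ S → 0 ≤ u' ((1 : ℝ) ⊗ₜ[ℤ] v) := fun v hv hvS => by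
        have := hF S hM (Finset.empty_subset _) ℓ (by simp) (fun v hv _ => hℓ v hv) v
          (by simpa using hv) hvS
        rw [hu'ℓ]
        have : (ℓ v : ℝ) ≤ 0 := by exact_mod_cast this
        linarith
      obtain ⟨A, hAM, c, hA, hc, hsum⟩ := hK.exists_pos_coeff (hF1 x).1 (hF2 x)
      change u (F x) x < u' x
      have hval : ∀ w : Module.Dual ℝ (RealSpace N),
          w x = ∑ v ∈ A, c v * w ((1 : ℝ) ⊗ₜ[ℤ] v) := fun w => by
        rw [← hsum, map_sum]
        exact Finset.sum_congr rfl fun v _ => by rw [map_smul, smul_eq_mul]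
      rw [hval (u (F x)), hval u', Finset.sum_congr rfl fun v hv => by
        rw [hu _ (hF1 x) v (hAM hv)]]
      obtain ⟨v₀, hv₀, hv₀S⟩ := Finset.not_subset.1 fun hAS => hx (by
        rw [← hsum]
        exact cone_mono (Finset.coe_subset.2 hAS) (sum_mem_cone fun v hv => (hc v hv).le))
      refine Finset.sum_lt_sum (fun v hv => ?_) ⟨v₀, hv₀, ?_⟩
      · refine mul_le_mul_of_nonneg_left ?_ (hc v hv).le
        by_cases hvS : v ∈ S
        · rw [hu'v v hvS]
        · linarith [hout v (hK.singleton_mem hA hv) hvS]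
      · refine mul_lt_mul_of_pos_left ?_ (hc v₀ hv₀)
        linarith [hout v₀ (hK.singleton_mem hA hv₀) hv₀S]

end IsLatticeFan

end FromReal

section Star

variable {N : Type*} [AddCommGroup N]

/-! ### Toric subvarieties -/

/-- The complex of the star of `T`: the images of the members of the link of `T` in the quotient
of the lattice by `L`, which is to be the sublattice generated by `T`. -/
def starComplex (K : Set (Finset N)) (T : Finset N) (L : Submodule ℤ N) : Set (Finset (N ⧸ L)) :=
  {B | ∃ A, A ∪ T ∈ K ∧ Disjoint A T ∧ B = A.image L.mkQ}

lemma exists_sub_of_mem_span {T : Finset N} {y : N} (hy : y ∈ Submodule.span ℤ (T : Set N)) :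
    ∃ f g : N →₀ ℕ, f.support ⊆ T ∧ g.support ⊆ T ∧ y + latticeSum f = latticeSum g := by
  induction hy using Submodule.span_induction with
  | mem y hy =>
    refine ⟨0, Finsupp.single y 1, by simp, ?_, by simp⟩
    exact Finsupp.support_single_subset.trans (by simpa using hy)
  | zero => exact ⟨0, 0, by simp, by simp, by simp⟩
  | add y z _ _ hy hz =>
    obtain ⟨f, g, hf, hg, h⟩ := hy
    obtain ⟨f', g', hf', hg', h'⟩ := hz
    refine ⟨f + f', g + g', Finsupp.support_add.trans (Finset.union_subset hf hf'),
      Finsupp.support_add.trans (Finset.union_subset hg hg'), ?_⟩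
    rw [map_add, map_add, ← h, ← h']; abel
  | smul c y _ hy =>
    obtain ⟨f, g, hf, hg, h⟩ := hy
    obtain ⟨n, rfl | rfl⟩ := c.eq_nat_or_neg
    · refine ⟨n • f, n • g, Finsupp.support_smul.trans hf, Finsupp.support_smul.trans hg, ?_⟩
      rw [map_nsmul, map_nsmul, ← h, smul_add, natCast_zsmul]
    · refine ⟨n • g, n • f, Finsupp.support_smul.trans hg, Finsupp.support_smul.trans hf, ?_⟩
      rw [map_nsmul, map_nsmul, ← h, smul_add, neg_smul, natCast_zsmul]; abel

namespace IsLatticeFan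

variable {K : Set (Finset N)} (hK : IsLatticeFan K) {T : Finset N} {L : Submodule ℤ N}
  (hL : L = Submodule.span ℤ (T : Set N))
include hK hL

/-- Combinations supported on the link of `T` are determined by their values modulo `T`. -/
lemma eq_of_mkQ_eq {f g : N →₀ ℕ} (hf : f.support ∪ T ∈ K) (hg : g.support ∪ T ∈ K)
    (hfT : Disjoint f.support T) (hgT : Disjoint g.support T)
    (h : L.mkQ (latticeSum f) = L.mkQ (latticeSum g)) : f = g := by
  have hy : latticeSum f - latticeSum g ∈ L := (Submodule.Quotient.eq L).1 h
  rw [hL] at hy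
  obtain ⟨t, t', ht, ht', htt⟩ := exists_sub_of_mem_span hy
  have heq := hK.inj (f + t) (g + t')
    (hK.down _ hf _ (Finsupp.support_add.trans (Finset.union_subset_union_right ht)))
    (hK.down _ hg _ (Finsupp.support_add.trans (Finset.union_subset_union_right ht')))
    (by rw [map_add, map_add, ← htt]; abel)
  ext v
  by_cases hv : v ∈ T
  · rw [Finsupp.notMem_support_iff.1 (Finset.disjoint_right.1 hfT hv),
      Finsupp.notMem_support_iff.1 (Finset.disjoint_right.1 hgT hv)]
  · have := DFunLike.congr_fun heq v
    rwa [Finsupp.add_apply, Finsupp.add_apply,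
      Finsupp.notMem_support_iff.1 (fun h => hv (ht h)),
      Finsupp.notMem_support_iff.1 (fun h => hv (ht' h)), add_zero, add_zero] at this

lemma eq_of_mkQ_eq_of_mem {v w : N} (hv : insert v T ∈ K) (hw : insert w T ∈ K) (hvT : v ∉ T)
    (hwT : w ∉ T) (h : L.mkQ v = L.mkQ w) : v = w := by
  have hs : ∀ v : N, (Finsupp.single v 1 : N →₀ ℕ).support = {v} := fun v =>
    Finsupp.support_single v one_ne_zero
  have := hK.eq_of_mkQ_eq hL (f := Finsupp.single v 1) (g := Finsupp.single w 1)
    (by rwa [hs]) (by rwa [hs]) (by rw [hs]; simpa) (by rw [hs]; simpa) (by simpa using h)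
  by_contra hne
  have h1 := DFunLike.congr_fun this v
  rw [Finsupp.single_eq_same, Finsupp.single_eq_of_ne hne] at h1
  exact one_ne_zero h1

omit hL in
lemma insert_mem_of_link {A : Finset N} (hA : A ∪ T ∈ K) {v : N} (hv : v ∈ A) : insert v T ∈ K :=
  hK.down _ hA _ (Finset.insert_subset (Finset.mem_union_left _ hv) Finset.subset_union_right)

lemma subset_of_image_subset {A B : Finset N} (hA : A ∪ T ∈ K) (hB : B ∪ T ∈ K)
    (hAT : Disjoint A T) (hBT : Disjoint B T) (h : A.image L.mkQ ⊆ B.image L.mkQ) : A ⊆ B := by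
  intro v hv
  obtain ⟨w, hw, hvw⟩ := Finset.mem_image.1 (h (Finset.mem_image_of_mem _ hv))
  rwa [← hK.eq_of_mkQ_eq_of_mem hL (hK.insert_mem_of_link hB hw)
    (hK.insert_mem_of_link hA hv) (Finset.disjoint_left.1 hBT hw)
    (Finset.disjoint_left.1 hAT hv) hvw]

/-- The star of a cone is a complete nonsingular fan in the quotient lattice. -/
theorem starComplex (hT : T ∈ K) : IsLatticeFan (starComplex K T L) := by
  -- combinations in the quotient lift to combinations supported on the link
  have lift : ∀ f : N ⧸ L →₀ ℕ, f.support ∈ ToricFan.starComplex K T L → ∃ g : N →₀ ℕ,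
      g.support ∪ T ∈ K ∧ Disjoint g.support T ∧ g.mapDomain L.mkQ = f ∧
      L.mkQ (latticeSum g) = latticeSum f := by
    rintro f ⟨A, hA, hAT, hfA⟩
    have hinj : ∀ v ∈ A, ∀ w ∈ A, L.mkQ v = L.mkQ w → v = w := fun v hv w hw h =>
      hK.eq_of_mkQ_eq_of_mem hL (hK.insert_mem_of_link hA hv) (hK.insert_mem_of_link hA hw)
        (Finset.disjoint_left.1 hAT hv) (Finset.disjoint_left.1 hAT hw) h
    have hsub : (∑ v ∈ A, Finsupp.single v (f (L.mkQ v))).support ⊆ A := fun v hv => by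
      obtain ⟨w, hw, hvw⟩ := Finset.mem_biUnion.1 (Finsupp.support_finsetSum hv)
      have := Finsupp.support_single_subset hvw
      rw [Finset.mem_singleton] at this
      exact this ▸ hw
    refine ⟨∑ v ∈ A, Finsupp.single v (f (L.mkQ v)),
      hK.down _ hA _ (Finset.union_subset_union_left hsub),
      Finset.disjoint_of_subset_left hsub hAT, ?_, ?_⟩
    · rw [Finsupp.mapDomain_finsetSum]
      simp only [Finsupp.mapDomain_single]
      conv_rhs => rw [← Finsupp.sum_single f, Finsupp.sum, hfA]
      rw [Finset.sum_image hinj]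
    · rw [map_sum, map_sum, Finsupp.linearCombination_apply, Finsupp.sum, hfA,
        Finset.sum_image hinj]
      refine Finset.sum_congr rfl fun v _ => ?_
      rw [Finsupp.linearCombination_single, map_nsmul]
      rfl
  refine ⟨?_, ?_, ?_, ?_⟩
  · refine (hK.finite.image fun A => (A \ T).image L.mkQ).subset ?_
    rintro _ ⟨A, hA, hAT, rfl⟩
    refine ⟨_, hA, ?_⟩
    dsimp only
    rw [Finset.union_sdiff_cancel_right hAT]
  · rintro _ ⟨A, hA, hAT, rfl⟩ B hB
    refine ⟨A.filter fun v => L.mkQ v ∈ B,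
      hK.down _ hA _ (Finset.union_subset_union_left (Finset.filter_subset _ _)),
      Finset.disjoint_of_subset_left (Finset.filter_subset _ _) hAT, ?_⟩
    ext y
    constructor
    · intro hy
      obtain ⟨v, hv, rfl⟩ := Finset.mem_image.1 (hB hy)
      exact Finset.mem_image_of_mem _ (Finset.mem_filter.2 ⟨hv, hy⟩)
    · intro hy
      obtain ⟨v, hv, rfl⟩ := Finset.mem_image.1 hy
      exact (Finset.mem_filter.1 hv).2
  · intro f f' hf hf' hff
    obtain ⟨g, h1, h2, rfl, h3⟩ := lift f hf
    obtain ⟨g', h1', h2', rfl, h3'⟩ := lift f' hf'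
    rw [hK.eq_of_mkQ_eq hL h1 h1' h2 h2' (by rw [h3, h3', hff])]
  · intro y
    obtain ⟨x, rfl⟩ := L.mkQ_surjective y
    obtain ⟨n, f, hf, hfx⟩ := hK.exists_add_sum hT x
    have hT0 : ∀ v ∈ T, L.mkQ v = 0 := fun v hv => by
      rw [Submodule.mkQ_apply, Submodule.Quotient.mk_eq_zero, hL]
      exact Submodule.subset_span hv
    refine ⟨(f.filter fun v => v ∉ T).mapDomain L.mkQ, ?_, ?_⟩
    · have hs : (f.filter fun v => v ∉ T).support = f.support \ T := by
        rw [Finsupp.support_filter]; ext v; simp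
      refine ⟨f.support \ T, by rwa [Finset.sdiff_union_self_eq_union], Finset.sdiff_disjoint, ?_⟩
      rw [← hs]
      refine Finset.Subset.antisymm Finsupp.mapDomain_support ?_
      intro y hy
      obtain ⟨v, hv, rfl⟩ := Finset.mem_image.1 hy
      rw [Finsupp.mem_support_iff, Finsupp.mapDomain, Finsupp.sum_apply, Finsupp.sum]
      refine (Finset.sum_pos' (fun _ _ => Nat.zero_le _) ⟨v, hv, ?_⟩).ne'
      rw [Finsupp.single_eq_same]
      exact Nat.pos_of_ne_zero (Finsupp.mem_support_iff.1 hv)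
    · rw [Finsupp.linearCombination_mapDomain]
      have h1 : L.mkQ (latticeSum f) = L.mkQ x := by
        rw [hfx, map_add, map_nsmul, map_sum, Finset.sum_eq_zero hT0, smul_zero, zero_add]
      rw [← h1, Finsupp.linearCombination_apply, Finsupp.linearCombination_apply,
        Finsupp.sum_filter_index, Finsupp.sum, map_sum,
        ← Finset.sum_filter_add_sum_filter_not f.support (fun v => v ∉ T)]
      rw [Finset.sum_eq_zero (s := f.support.filter fun v => ¬ v ∉ T), add_zero]
      · refine Finset.sum_congr (by rw [Finsupp.support_filter]) fun v _ => ?_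
        rw [map_nsmul]; rfl
      · intro v hv
        rw [id, map_nsmul, hT0 v (not_not.1 (Finset.mem_filter.1 hv).2), smul_zero]

/-- Facets of the star are the images of the facets that contain `T`. -/
lemma isStarFano_starComplex_iff :
    IsStarFano (ToricFan.starComplex K T L) ∅ ↔ IsStarFano K T := by
  have hT0 : ∀ v ∈ T, L.mkQ v = 0 := fun v hv => by
    rw [Submodule.mkQ_apply, Submodule.Quotient.mk_eq_zero, hL]
    exact Submodule.subset_span hv
  constructor
  · intro h M hM hTM ℓ h0 h1 w hw hwM
    have hMT : M \ T ∪ T = M := Finset.sdiff_union_of_subset hTM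
    have hfacet : IsFacet (ToricFan.starComplex K T L) ((M \ T).image L.mkQ) := by
      refine ⟨⟨M \ T, hMT.symm ▸ hM.1, Finset.sdiff_disjoint, rfl⟩, ?_⟩
      rintro _ ⟨A, hA, hAT, rfl⟩ hsub
      have hMA := hK.subset_of_image_subset hL (hMT.symm ▸ hM.1) hA Finset.sdiff_disjoint hAT hsub
      have := hM.2 _ hA (hMT ▸ Finset.union_subset_union_left hMA)
      rw [← this, Finset.union_sdiff_cancel_right hAT]
    have hker : L ≤ LinearMap.ker ℓ := by
      rw [hL, Submodule.span_le]; exact fun v hv => h0 v hv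
    have hwT : w ∉ T := fun hwT => hwM (hTM hwT)
    have := h _ hfacet (Finset.empty_subset _) (L.liftQ ℓ hker) (by simp) (fun y hy _ => by
        obtain ⟨v, hv, rfl⟩ := Finset.mem_image.1 hy
        rw [Submodule.mkQ_apply, Submodule.liftQ_apply]
        exact h1 v (Finset.mem_sdiff.1 hv).1 (Finset.mem_sdiff.1 hv).2) (L.mkQ w)
      ⟨{w}, by simpa using hw, by simpa using hwT, by simp⟩ (fun hmem => by
        obtain ⟨v, hv, hvw⟩ := Finset.mem_image.1 hmem
        have hv' := Finset.mem_sdiff.1 hv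
        have := hK.eq_of_mkQ_eq_of_mem hL
          (hK.down _ hM.1 _ (Finset.insert_subset hv'.1 hTM)) hw hv'.2 hwT hvw
        exact hwM (this ▸ hv'.1))
    rwa [Submodule.mkQ_apply, Submodule.liftQ_apply] at this
  · rintro h _ ⟨⟨A, hA, hAT, rfl⟩, hmax⟩ - ℓ - h1 y hy hyA
    obtain ⟨B, hB, hBT, hyB⟩ : {y} ∈ ToricFan.starComplex K T L := by simpa using hy
    obtain ⟨w, hw, hwy⟩ : ∃ w ∈ B, L.mkQ w = y := by
      rw [← Finset.mem_image, ← hyB]; simp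
    subst hwy
    have hfacet : IsFacet K (A ∪ T) := by
      refine ⟨hA, fun C hC hsub => ?_⟩
      have hTC : T ⊆ C := Finset.subset_union_right.trans hsub
      have hCT : C \ T ∪ T = C := Finset.sdiff_union_of_subset hTC
      have hAC : A ⊆ C \ T := fun v hv => Finset.mem_sdiff.2
        ⟨hsub (Finset.mem_union_left _ hv), Finset.disjoint_left.1 hAT hv⟩
      have := hmax ((C \ T).image L.mkQ) ⟨C \ T, hCT.symm ▸ hC, Finset.sdiff_disjoint, rfl⟩
        (Finset.image_subset_image hAC)
      have := hK.subset_of_image_subset hL (hCT.symm ▸ hC) hA Finset.sdiff_disjoint hAT this.le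
      rw [← hCT, this.antisymm hAC]
    refine h _ hfacet Finset.subset_union_right (ℓ ∘ₗ L.mkQ) (fun v hv => ?_) (fun v hv hvT => ?_) w
      (hK.insert_mem_of_link hB hw) (fun hm => ?_)
    · rw [LinearMap.comp_apply, hT0 v hv, map_zero]
    · exact h1 _ (Finset.mem_image_of_mem _ ((Finset.mem_union.1 hv).resolve_right hvT))
        (Finset.notMem_empty _)
    · rcases Finset.mem_union.1 hm with hm | hm
      · exact hyA (Finset.mem_image_of_mem _ hm)
      · exact Finset.disjoint_left.1 hBT hw hm

omit hL in
lemma coneLattice_cone (hT : T ∈ K) :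
    coneLattice (cone (T : Set N)) = Submodule.span ℤ (T : Set N) := by
  refine le_antisymm (Submodule.span_le.2 fun y hy => ?_)
    (Submodule.span_mono fun v hv => tmul_mem_cone hv)
  obtain ⟨M, hM, hTM⟩ := hK.exists_facet hT
  have hy' := (hK.mem_cone_iff hM hTM).1 hy
  rw [SetLike.mem_coe, ← (hK.basis hM).sum_repr y]
  refine Submodule.sum_mem _ fun i _ => ?_
  by_cases hi : (i : N) ∈ T
  · rw [hK.basis_apply]
    exact Submodule.smul_mem _ _ (Submodule.subset_span hi)
  · have := (hy' i).2 hi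
    rw [baseChange_repr_one_tmul] at this
    rw [show (hK.basis hM).repr y i = 0 by exact_mod_cast this, zero_smul]
    exact zero_mem _

omit hL in
lemma star_fanOf (hT : T ∈ K) :
    star (fanOf K) (cone (T : Set N)) =
      fanOf (ToricFan.starComplex K T (coneLattice (cone (T : Set N)))) := by
  have hL := hK.coneLattice_cone hT
  have himage : ∀ L : Submodule ℤ N, L = Submodule.span ℤ (T : Set N) → ∀ S : Finset N, T ⊆ S →
      (cone (S : Set N)).map (realMap L.mkQ) =
      cone (((S \ T).image L.mkQ : Finset (N ⧸ L)) : Set (N ⧸ L)) := by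
    intro L hL S hTS
    rw [map_cone]
    refine le_antisymm (cone_le_iff.2 ?_) (cone_mono ?_)
    · rintro _ ⟨v, hv, rfl⟩
      by_cases hvT : v ∈ T
      · have : L.mkQ v = 0 := by
          rw [Submodule.mkQ_apply, Submodule.Quotient.mk_eq_zero, hL]
          exact Submodule.subset_span hvT
        rw [this, TensorProduct.tmul_zero]; exact zero_mem _
      · exact tmul_mem_cone (Finset.mem_coe.2
          (Finset.mem_image_of_mem _ (Finset.mem_sdiff.2 ⟨hv, hvT⟩)))
    · rw [Finset.coe_image]
      exact Set.image_mono (by simp)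
  ext c
  constructor
  · rintro ⟨_, ⟨S, hS, rfl⟩, hTS, rfl⟩
    have hTS' := (hK.cone_le_cone_iff (fun v hv => hK.singleton_mem hT hv) hS).1 hTS
    refine ⟨_, ⟨S \ T, ?_, Finset.sdiff_disjoint, rfl⟩, (himage _ hL S hTS').symm⟩
    rwa [Finset.sdiff_union_of_subset hTS']
  · rintro ⟨_, ⟨A, hA, hAT, rfl⟩, rfl⟩
    refine ⟨_, ⟨A ∪ T, hA, rfl⟩, cone_mono (Finset.coe_subset.2 Finset.subset_union_right), ?_⟩
    have := himage _ hL (A ∪ T) Finset.subset_union_right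
    rw [Finset.union_sdiff_cancel_right hAT] at this
    exact this.symm

omit hL in
/-- The toric subvariety of the cone of `T` is Fano if and only if the linear forms of the facets
around `T` satisfy the condition on the link of `T`. -/
theorem isFano_star_iff (hT : T ∈ K) :
    IsFano (star (fanOf K) (cone (T : Set N))) ↔ IsStarFano K T := by
  have hL := hK.coneLattice_cone hT
  rw [hK.star_fanOf hT, (hK.starComplex hL hT).isFano_iff, hK.isStarFano_starComplex_iff hL]

end IsLatticeFan

end Star

section Dictionary

variable {N : Type*} [AddCommGroup N]

/-! ### The conditions of the theorem for the real fan of a complex -/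

lemma isComplete_of_isBlowUp {Δ Δ' : Set (PointedCone ℝ (RealSpace N))} {ρ : N}
    (h : IsBlowUp Δ Δ' ρ) (hΔ : IsComplete Δ) : IsComplete Δ' := by
  obtain ⟨P, -, -, -, -, rfl⟩ := h
  intro x
  obtain ⟨σ, ⟨hσ, -⟩ | ⟨μ, hμ, hPμ, τ, hτ, -, rfl⟩, hx⟩ := hΔ x
  · exact ⟨σ, hσ, hx⟩
  · refine ⟨μ, hμ, (sup_le hτ.le (cone_le_iff.2 ?_)) hx⟩
    rintro _ rfl
    rw [TensorProduct.tmul_sum]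
    exact Submodule.sum_mem _ fun v hv => hPμ (tmul_mem_cone hv)

namespace IsLatticeFan

variable {K : Set (Finset N)} (hK : IsLatticeFan K)
include hK

lemma starSubdivision_fanOf {P : Finset N} (hP : P ∈ K) :
    starSubdivision (fanOf K) P = fanOf (ToricFan.subdivision K P) := by
  have hle : ∀ {A}, A ∈ K → (cone (P : Set N) ≤ cone (A : Set N) ↔ P ⊆ A) := fun hA =>
    hK.cone_le_cone_iff (fun v hv => hK.singleton_mem hP hv) hA
  have hins : ∀ A : Finset N, cone (A : Set N) ⊔ cone {∑ v ∈ P, v} =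
      cone ((insert (∑ v ∈ P, v) A : Finset N) : Set N) := fun A => by
    rw [← cone_union, Finset.coe_insert, Set.union_singleton]
  ext c
  constructor
  · rintro (⟨⟨A, hA, rfl⟩, hPA⟩ | ⟨_, ⟨B, hB, rfl⟩, hPB, τ, hτ, hPτ, rfl⟩)
    · exact ⟨A, Or.inl ⟨hA, fun h => hPA ((hle hA).2 h)⟩, rfl⟩
    · obtain ⟨A, hAB, rfl⟩ := (hK.isFaceOf_iff hB).1 hτ
      have hA := hK.down _ hB _ hAB
      rw [hins]
      exact ⟨_, Or.inr ⟨A, hA, fun h => hPτ ((hle hA).2 h),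
        hK.down _ hB _ (Finset.union_subset hAB ((hle hB).1 hPB)), rfl⟩, rfl⟩
  · rintro ⟨_, ⟨hA, hPA⟩ | ⟨A, hA, hPA, hAP, rfl⟩, rfl⟩
    · exact Or.inl ⟨⟨_, hA, rfl⟩, fun h => hPA ((hle hA).1 h)⟩
    · refine Or.inr ⟨_, ⟨A ∪ P, hAP, rfl⟩, (hle hAP).2 Finset.subset_union_right,
        cone (A : Set N), (hK.isFaceOf_iff hAP).2 ⟨A, Finset.subset_union_left, rfl⟩,
        fun h => hPA ((hle hA).1 h), (hins A).symm⟩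

lemma isBlowUp_iff {K' : Set (Finset N)} (hK' : IsLatticeFan K') {ρ : N} :
    IsBlowUp (fanOf K) (fanOf K') ρ ↔ ∃ P, IsSubdivision K K' P ∧ ρ = ∑ v ∈ P, v := by
  constructor
  · rintro ⟨P, h2, hv, hP, rfl, heq⟩
    replace hP := (hK'.cone_mem_iff fun v hw => hK'.isRayGenerator_iff.1 (hv v hw)).1 hP
    rw [hK'.starSubdivision_fanOf hP] at heq
    exact ⟨P, ⟨hK, hK', hP, h2, hK.eq_of_fanOf_eq (hK'.subdivision hP h2) heq⟩, rfl⟩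
  · rintro ⟨P, h, rfl⟩
    refine ⟨P, h.two_le_card, fun v hv => hK'.isRayGenerator_iff.2 (hK'.singleton_mem h.mem hv),
      ⟨P, h.mem, rfl⟩, rfl, ?_⟩
    rw [hK'.starSubdivision_fanOf h.mem, ← h.eq]

lemma isPrimitiveSet_iff {P : Finset N} : IsPrimitiveSet (fanOf K) P ↔ IsPrimitive K P := by
  have hr : (∀ ρ ∈ P, IsRayGenerator (fanOf K) ρ) ↔ ∀ v ∈ P, {v} ∈ K :=
    forall₂_congr fun _ _ => hK.isRayGenerator_iff
  rw [IsPrimitiveSet, IsPrimitive, hr]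
  refine and_congr_right fun hP => ?_
  rw [hK.cone_mem_iff hP]
  refine and_congr_right fun _ => forall₂_congr fun v _ => ?_
  rw [← Finset.coe_erase, hK.cone_mem_iff fun w hw => hP w (Finset.mem_of_mem_erase hw)]

lemma hasSimplePrimitiveRelations_iff :
    HasSimplePrimitiveRelations (fanOf K) ↔ HasShortRelations K ∧ HasDistinctSums K := by
  simp only [HasSimplePrimitiveRelations, hK.isPrimitiveSet_iff, hK.isRayGenerator_iff]
  refine and_congr ?_ ?_
  · refine forall₂_congr fun P _ => or_congr_right ?_
    exact ⟨fun ⟨ρ, hρ, h⟩ => h ▸ hρ, fun h => ⟨_, h, rfl⟩⟩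
  · constructor
    · intro h P Q hP hQ hv hPQ
      exact h _ hv P Q hP hQ rfl hPQ.symm
    · rintro h ρ hρ P Q hP hQ rfl hPQ
      exact h P Q hP hQ hρ hPQ.symm

/-- A blow-down is only known to be a nonsingular fan; it is complete because its cones contain
those of the blow-up, and so it comes from a complex as well. -/
theorem fano_iff : FanoWithSubvarietiesAndBlowDowns (fanOf K) ↔
    HasSimplePrimitiveRelations (fanOf K) := by
  rw [hK.hasSimplePrimitiveRelations_iff]
  constructor
  · rintro ⟨-, hstar, hblow⟩
    have hs : HasShortRelations K := hK.hasShortRelations fun T hT =>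
      (hK.isFano_star_iff hT).1 (hstar _ ⟨T, hT, rfl⟩)
    refine ⟨hs, hK.hasDistinctSums hs fun K' P h => ?_⟩
    have hK' := h.isLatticeFan'
    exact hK'.isFano_iff.1 (hblow _ hK'.isFan hK'.isNonsingular
      ⟨_, (hK.isBlowUp_iff hK').2 ⟨P, h, rfl⟩⟩)
  · rintro ⟨hs, hd⟩
    refine ⟨hK.isFano_iff.2 (hK.isStarFano hs ∅), ?_, ?_⟩
    · rintro _ ⟨T, hT, rfl⟩
      exact (hK.isFano_star_iff hT).2 (hK.isStarFano hs T)
    · rintro Δ' hfan hnon ⟨ρ, hρ⟩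
      obtain ⟨K', hK', rfl⟩ := exists_isLatticeFan hfan
        (isComplete_of_isBlowUp hρ hK.isComplete) hnon
      obtain ⟨P, h, -⟩ := (hK.isBlowUp_iff hK').1 hρ
      exact hK'.isFano_iff.2 (hK'.isStarFano (h.hasShortRelations hs hd) ∅)

end IsLatticeFan

end Dictionary

section Sequences

variable {N : Type*} [AddCommGroup N]

/-! ### Sequences of blow-downs -/

/-- A complete nonsingular fan that satisfies the conditions on primitive relations. -/
structure IsSimpleFan (K : Set (Finset N)) : Prop where
  isLatticeFan : IsLatticeFan K
  hasShortRelations : HasShortRelations K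
  hasDistinctSums : HasDistinctSums K

/-- Some sequence of blow-downs leads from `K` to `K₀`. -/
inductive ContractsTo : Set (Finset N) → Set (Finset N) → Prop
  | refl (K : Set (Finset N)) : ContractsTo K K
  | step {K K' K₀ : Set (Finset N)} {P : Finset N} :
      IsSubdivision K K' P → ContractsTo K' K₀ → ContractsTo K K₀

lemma IsSubdivision.isSimpleFan {K K' : Set (Finset N)} {P : Finset N} (h : IsSubdivision K K' P)
    (hK : IsSimpleFan K) : IsSimpleFan K' :=
  ⟨h.isLatticeFan', h.hasShortRelations hK.hasShortRelations hK.hasDistinctSums,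
    h.hasDistinctSums hK.hasDistinctSums⟩

lemma ContractsTo.vertex {K K₀ : Set (Finset N)} (h : ContractsTo K K₀) {v : N}
    (hv : {v} ∈ K₀) : {v} ∈ K := by
  induction h with
  | refl => exact hv
  | step h _ ih => exact (h.vertex_iff.1 (ih hv)).1

/-- Blowing down as long as possible ends with a fan all of whose primitive sets sum to zero. -/
lemma IsSimpleFan.exists_contractsTo {K : Set (Finset N)} (hK : IsSimpleFan K) :
    ∃ K₀, ContractsTo K K₀ ∧ IsSimpleFan K₀ ∧ ∀ P, IsPrimitive K₀ P → ∑ v ∈ P, v = 0 := by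
  obtain ⟨W, hW⟩ := hK.isLatticeFan.exists_vertices
  induction W using Finset.strongInduction generalizing K with
  | H W ih =>
    by_cases h : ∀ P, IsPrimitive K P → ∑ v ∈ P, v = 0
    · exact ⟨K, .refl K, hK, h⟩
    · push Not at h
      obtain ⟨P, hP, h0⟩ := h
      have hv := (hK.hasShortRelations P hP).resolve_left h0
      have hsub := hK.isLatticeFan.isSubdivision_contraction hK.hasShortRelations hP hv
      obtain ⟨K₀, h1, h2⟩ := ih (W.erase (∑ v ∈ P, v)) (Finset.erase_ssubset ((hW _).2 hv))
        (hsub.isSimpleFan hK) fun v => by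
          rw [Finset.mem_erase, hW, hsub.vertex_iff, and_comm]
      exact ⟨K₀, .step hsub h1, h2⟩

/-- The vertices that disappear may be contracted in any order: each of them can come first. -/
lemma ContractsTo.exists_first {K K₀ : Set (Finset N)} (h : ContractsTo K K₀) (hK : IsSimpleFan K)
    {ρ : N} (hρ : {ρ} ∈ K) (hρ₀ : {ρ} ∉ K₀) :
    ∃ K' P, IsSubdivision K K' P ∧ ∑ v ∈ P, v = ρ ∧ ContractsTo K' K₀ := by
  induction h with
  | refl => exact absurd hρ hρ₀
  | step h₁ hc ih =>
    rename_i K K₁ K₀ P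
    by_cases hP : ∑ v ∈ P, v = ρ
    · exact ⟨K₁, P, h₁, hP, hc⟩
    · obtain ⟨K₂, Q₁, h₂, hQ₁, hc₂⟩ := ih (h₁.isSimpleFan hK)
        (h₁.vertex_iff.2 ⟨hρ, Ne.symm hP⟩) hρ₀
      obtain ⟨K', Q, R, h₃, h₄, hQ, -⟩ :=
        h₁.exists_swap h₂ hK.hasShortRelations hK.hasDistinctSums
      exact ⟨K', Q, h₃, hQ.trans hQ₁, .step h₄ hc₂⟩

lemma ContractsTo.exists_sequence {K₀ : Set (Finset N)} (l : List N) (hl : l.Nodup) :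
    ∀ {K : Set (Finset N)}, ContractsTo K K₀ → IsSimpleFan K →
    (∀ ρ, ρ ∈ l ↔ {ρ} ∈ K ∧ {ρ} ∉ K₀) →
    ∃ Γ : Fin (l.length + 1) → Set (Finset N), Γ 0 = K ∧ Γ (Fin.last _) = K₀ ∧
      (∀ i : Fin l.length, ∃ P, IsSubdivision (Γ i.castSucc) (Γ i.succ) P ∧
        l.get i = ∑ v ∈ P, v) ∧ ∀ i, IsSimpleFan (Γ i) := by
  induction l with
  | nil =>
    intro K h hK hmem
    have : K = K₀ := by
      cases h with
      | refl => rfl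
      | step h₁ hc =>
        refine absurd ((hmem _).2 ⟨h₁.sum_mem, fun h => ?_⟩) List.not_mem_nil
        exact (h₁.vertex_iff.1 (hc.vertex h)).2 rfl
    subst this
    exact ⟨fun _ => K, rfl, rfl, fun i => i.elim0, fun _ => hK⟩
  | cons ρ l ih =>
    intro K h hK hmem
    obtain ⟨hρl, hl'⟩ := List.nodup_cons.1 hl
    obtain ⟨hρ, hρ₀⟩ := (hmem ρ).1 List.mem_cons_self
    obtain ⟨K', P, hsub, hP, hc⟩ := h.exists_first hK hρ hρ₀
    obtain ⟨Γ, h0, hlast, hΓ, hΓ'⟩ := ih hl' hc (hsub.isSimpleFan hK) fun v => by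
      rw [hsub.vertex_iff, hP]
      have := hmem v
      rw [List.mem_cons] at this
      constructor
      · intro hv
        have h1 := this.1 (Or.inr hv)
        exact ⟨⟨h1.1, fun e => hρl (e ▸ hv)⟩, h1.2⟩
      · rintro ⟨⟨h1, h2⟩, h3⟩
        exact (this.2 ⟨h1, h3⟩).resolve_left h2
    refine ⟨Fin.cons K Γ, rfl, ?_, ?_, ?_⟩
    · rw [← hlast]; rfl
    · intro i
      refine Fin.cases ?_ (fun i => ?_) i
      · refine ⟨P, ?_, hP.symm⟩
        change IsSubdivision K (Γ 0) P
        rwa [h0]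
      · exact hΓ i
    · intro i
      refine Fin.cases hK (fun i => ?_) i
      exact hΓ' i

end Sequences

section Product

variable {N : Type*} [AddCommGroup N]

/-! ### Fans without contractible vertices are products of projective spaces -/

lemma cone_iUnion {ι : Type*} (S : ι → Set N) : cone (⋃ i, S i) = ⨆ i, cone (S i) := by
  rw [cone, Set.image_iUnion]
  exact Submodule.span_iUnion _

namespace IsLatticeFan

variable {K : Set (Finset N)} (hK : IsLatticeFan K)
include hK

/-- Primitive sets with sum zero are disjoint. -/
lemma primitive_eq_of_mem {P Q : Finset N} (hP : IsPrimitive K P) (hQ : IsPrimitive K Q)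
    (hP0 : ∑ v ∈ P, v = 0) (hQ0 : ∑ v ∈ Q, v = 0) {x : N} (hxP : x ∈ P) (hxQ : x ∈ Q) : P = Q := by
  have := hK.eq_of_sum_eq (hP.2.2 x hxP) (hQ.2.2 x hxQ) (by
    rw [← add_left_inj x, Finset.sum_erase_add _ _ hxP, Finset.sum_erase_add _ _ hxQ, hP0, hQ0])
  rw [← Finset.insert_erase hxP, this, Finset.insert_erase hxQ]

/-- By completeness, every vertex belongs to a primitive set. -/
lemma exists_primitive_mem {v : N} (hv : {v} ∈ K) : ∃ P, IsPrimitive K P ∧ v ∈ P := by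
  obtain ⟨f, hf, hfv⟩ := hK.surj (-v)
  have hn : insert v f.support ∉ K := fun h => by
    have h1 := hK.inj (f + Finsupp.single v 1) 0
      (hK.down _ h _ (Finsupp.support_add.trans (Finset.union_subset (Finset.subset_insert _ _)
        (Finsupp.support_single_subset.trans (by simp)))))
      (by simpa using hK.empty_mem) (by simp [map_add, hfv])
    have := DFunLike.congr_fun h1 v
    simp at this
  obtain ⟨P, hP, hprim⟩ := exists_primitive (K := K) (fun w hw => by
    rcases Finset.mem_insert.1 hw with rfl | hw
    · exact hv
    · exact hK.singleton_mem hf hw) hn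
  refine ⟨P, hprim, ?_⟩
  by_contra hvP
  refine hprim.2.1 (hK.down _ hf _ fun w hw => ?_)
  exact (Finset.mem_insert.1 (hP hw)).resolve_left fun h => hvP (h ▸ hw)

/-- If all primitive sets sum to zero, the complex is the join of the boundaries of the simplices
on the primitive sets, and the elements of all primitive sets except one of each form a basis of
the lattice. So the fan is that of a product of projective spaces. -/
theorem isProductOfProjectiveSpaces (h0 : ∀ P, IsPrimitive K P → ∑ v ∈ P, v = 0) :
    IsProductOfProjectiveSpaces (fanOf K) := by
  have hfin : {P | IsPrimitive K P}.Finite := by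
    obtain ⟨W, hW⟩ := hK.exists_vertices
    refine (W.powerset.finite_toSet).subset fun P hP => ?_
    exact Finset.mem_coe.2 (Finset.mem_powerset.2 fun v hv => (hW v).2 (hP.1 v hv))
  -- enumerate the primitive sets, and the elements of each of them
  obtain ⟨s, P, hPprim, hPinj, hPsurj⟩ : ∃ (s : ℕ) (P : Fin s → Finset N),
      (∀ i, IsPrimitive K (P i)) ∧ Function.Injective P ∧
      ∀ Q, IsPrimitive K Q → ∃ i, P i = Q := by
    refine ⟨hfin.toFinset.card, fun i => (hfin.toFinset.equivFin.symm i : Finset N), fun i => ?_,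
      Subtype.val_injective.comp (Equiv.injective _), fun Q hQ => ?_⟩
    · exact hfin.mem_toFinset.1 (hfin.toFinset.equivFin.symm i).2
    · exact ⟨hfin.toFinset.equivFin ⟨Q, hfin.mem_toFinset.2 hQ⟩, by simp⟩
  obtain ⟨d, p, hpinj, hpP⟩ : ∃ (d : Fin s → ℕ) (p : ∀ i, Fin (d i + 1) → N),
      (∀ i, Function.Injective (p i)) ∧ ∀ i, Finset.univ.image (p i) = P i := by
    have hcard : ∀ i, (P i).card = (P i).card - 1 + 1 := fun i => by
      have := hK.two_le_card (hPprim i); omega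
    refine ⟨fun i => (P i).card - 1,
      fun i j => ((P i).equivFinOfCardEq (hcard i)).symm j, fun i => ?_, fun i => ?_⟩
    · exact Subtype.val_injective.comp (Equiv.injective _)
    · ext v
      rw [Finset.mem_image]
      constructor
      · rintro ⟨j, -, rfl⟩
        exact (((P i).equivFinOfCardEq (hcard i)).symm j).2
      · intro hv
        exact ⟨(P i).equivFinOfCardEq (hcard i) ⟨v, hv⟩, Finset.mem_univ _, by simp⟩
  have hmem : ∀ i j, p i j ∈ P i := fun i j => by
    rw [← hpP]; exact Finset.mem_image_of_mem _ (Finset.mem_univ _)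
  have hidx : ∀ i v, v ∈ P i → ∃ j, p i j = v := fun i v hv => by
    rw [← hpP, Finset.mem_image] at hv
    obtain ⟨j, -, hj⟩ := hv
    exact ⟨j, hj⟩
  have hvert : ∀ v, {v} ∈ K → ∃ i j, p i j = v := fun v hv => by
    obtain ⟨Q, hQ, hvQ⟩ := hK.exists_primitive_mem hv
    obtain ⟨i, rfl⟩ := hPsurj Q hQ
    exact ⟨i, hidx i v hvQ⟩
  have hsig : ∀ i j i' j', p i j = p i' j' → (⟨i, j⟩ : Σ i, Fin (d i + 1)) = ⟨i', j'⟩ := by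
    intro i j i' j' h
    have : i = i' := hPinj (hK.primitive_eq_of_mem (hPprim i) (hPprim i') (h0 _ (hPprim i))
      (h0 _ (hPprim i')) (hmem i j) (h ▸ hmem i' j'))
    subst this
    rw [hpinj i h]
  have hsum : ∀ i, ∑ j, p i j = 0 := fun i => by
    rw [← h0 _ (hPprim i), ← hpP, Finset.sum_image fun a _ b _ h => hpinj i h]
  have hKiff : ∀ S : Finset N, (∀ v ∈ S, {v} ∈ K) → (∀ i, ∃ j, p i j ∉ S) → S ∈ K := by
    intro S hS h
    by_contra hn
    obtain ⟨Q, hQS, hQ⟩ := exists_primitive hS hn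
    obtain ⟨i, rfl⟩ := hPsurj Q hQ
    obtain ⟨j, hj⟩ := h i
    exact hj (hQS (hmem i j))
  have hKiff' : ∀ S ∈ K, ∀ i, ∃ j, p i j ∉ S := by
    intro S hS i
    by_contra! hcon
    refine (hPprim i).2.1 (hK.down _ hS _ fun v hv => ?_)
    obtain ⟨j, rfl⟩ := hidx i v hv
    exact hcon j
  -- the facet that omits the first element of each primitive set
  let q : (Σ i, Fin (d i)) → N := fun x => p x.1 x.2.succ
  have hq : Function.Injective q := by
    rintro ⟨i, j⟩ ⟨i', j'⟩ h
    have := hsig _ _ _ _ h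
    simp only [Sigma.mk.injEq] at this
    obtain ⟨rfl, h2⟩ := this
    rw [heq_eq_eq, Fin.succ_inj] at h2
    rw [h2]
  have hq0 : ∀ i, p i 0 ∉ Finset.univ.image q := fun i h => by
    obtain ⟨⟨i', j'⟩, -, h⟩ := Finset.mem_image.1 h
    have := hsig _ _ _ _ h
    simp only [Sigma.mk.injEq] at this
    obtain ⟨rfl, h2⟩ := this
    rw [heq_eq_eq] at h2
    exact Fin.succ_ne_zero _ h2
  have hM : IsFacet K (Finset.univ.image q) := by
    refine ⟨hKiff _ (fun v hv => ?_) fun i => ⟨0, hq0 i⟩, fun A hA hsub =>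
      Finset.Subset.antisymm (fun v hv => ?_) hsub⟩
    · obtain ⟨⟨i, j⟩, -, rfl⟩ := Finset.mem_image.1 hv
      exact (hPprim i).1 _ (hmem i _)
    · obtain ⟨i, j, rfl⟩ := hvert v (hK.singleton_mem hA hv)
      have hsucc : ∀ j, p i (Fin.succ j) ∈ Finset.univ.image q := fun j =>
        Finset.mem_image_of_mem q (Finset.mem_univ ⟨i, j⟩)
      obtain ⟨j', hj'⟩ := hKiff' A hA i
      cases j' using Fin.cases with
      | succ j' => exact absurd (hsub (hsucc j')) hj'
      | zero =>
        cases j using Fin.cases with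
        | zero => exact absurd hv hj'
        | succ j => exact hsucc j
  let σ : (Σ i, Fin (d i)) ≃ (Finset.univ.image q : Finset N) :=
    Equiv.ofBijective (fun x => ⟨q x, Finset.mem_image_of_mem q (Finset.mem_univ x)⟩) ⟨
      fun x y h => hq (congrArg Subtype.val h), fun ⟨v, hv⟩ => by
        obtain ⟨x, -, hx⟩ := Finset.mem_image.1 hv
        exact ⟨x, Subtype.ext hx⟩⟩
  let B : Module.Basis (Σ i, Fin (d i)) ℤ N := (hK.basis hM).reindex σ.symm
  have hB : ∀ x, B x = q x := fun x => by
    simp only [B, Module.Basis.reindex_apply, Equiv.symm_symm, hK.basis_apply]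
    rfl
  let e : N ≃ₗ[ℤ] (∀ i, Fin (d i) → ℤ) :=
    B.equivFun.trans (LinearEquiv.piCurry ℤ (fun (i : Fin s) (_ : Fin (d i)) => ℤ))
  have he1 : ∀ i (j : Fin (d i)), e (p i j.succ) = LinearMap.single ℤ _ i (Pi.single j 1) := by
    intro i j
    have : e (B ⟨i, j⟩) = LinearMap.single ℤ _ i (Pi.single j 1) := by
      ext i' j'
      simp only [e, LinearEquiv.trans_apply, Module.Basis.equivFun_self, LinearEquiv.piCurry_apply,
        Sigma.curry, LinearMap.coe_single]
      by_cases hi : i' = i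
      · subst hi
        rw [Pi.single_eq_same]
        by_cases hj : j' = j
        · subst hj; simp
        · simp [hj, Ne.symm hj]
      · rw [Pi.single_eq_of_ne hi]
        simp [Ne.symm hi]
    rw [← this, hB]
  have he : ∀ i k, e (p i k) = LinearMap.single ℤ (fun i => Fin (d i) → ℤ) i
      (projectiveRay (d i) k) := by
    intro i k
    cases k using Fin.cases with
    | succ j => rw [he1]; rfl
    | zero =>
      have h := congrArg e (hsum i)
      rw [Fin.sum_univ_succ, map_add, map_sum, map_zero] at h
      rw [eq_neg_of_add_eq_zero_left h]
      simp only [he1, projectiveRay, Fin.cons_zero, map_neg, map_sum]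
  have hcone : ∀ J : ∀ i, Set (Fin (d i + 1)),
      (cone (⋃ i, p i '' J i)).map (realMap e.toLinearMap) = ⨆ i,
        (cone (projectiveRay (d i) '' J i)).map
          (realMap (LinearMap.single ℤ (fun i => Fin (d i) → ℤ) i)) := by
    intro J
    rw [map_cone, Set.image_iUnion, cone_iUnion]
    refine iSup_congr fun i => ?_
    rw [map_cone, ← Set.image_comp, ← Set.image_comp]
    congr 1
    refine Set.image_congr fun k _ => ?_
    exact he i k
  refine ⟨s, d, e, Set.Subset.antisymm ?_ ?_⟩
  · rintro _ ⟨_, ⟨S, hS, rfl⟩, rfl⟩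
    refine ⟨fun i => cone (projectiveRay (d i) '' {k | p i k ∈ S}),
      fun i => ⟨{k | p i k ∈ S}, fun h => ?_, rfl⟩, ?_⟩
    · obtain ⟨j, hj⟩ := hKiff' S hS i
      have : j ∈ {k | p i k ∈ S} := by rw [h]; trivial
      exact hj this
    · rw [← hcone]
      dsimp only
      congr 2
      ext v
      rw [Set.mem_iUnion]
      constructor
      · intro hv
        obtain ⟨i, j, rfl⟩ := hvert v (hK.singleton_mem hS hv)
        exact ⟨i, j, hv, rfl⟩
      · rintro ⟨i, k, hk, rfl⟩
        exact hk
  · rintro _ ⟨τ, hτ, rfl⟩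
    choose J hJ hτJ using hτ
    obtain rfl : τ = fun i => cone (projectiveRay (d i) '' J i) := funext hτJ
    have hf : (⋃ i, p i '' J i).Finite :=
      Set.finite_iUnion fun i => (Set.toFinite _).image _
    refine ⟨_, ⟨hf.toFinset, hKiff _ (fun v hv => ?_) fun i => ?_, rfl⟩, ?_⟩
    · rw [Set.Finite.mem_toFinset, Set.mem_iUnion] at hv
      obtain ⟨i, k, -, rfl⟩ := hv
      exact (hPprim i).1 _ (hmem i k)
    · obtain ⟨j, hj⟩ := (Set.ne_univ_iff_exists_notMem _).1 (hJ i)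
      refine ⟨j, fun h => hj ?_⟩
      rw [Set.Finite.mem_toFinset, Set.mem_iUnion] at h
      obtain ⟨i', k, hk, h⟩ := h
      have := hsig _ _ _ _ h
      simp only [Sigma.mk.injEq] at this
      obtain ⟨rfl, h2⟩ := this
      rw [heq_eq_eq] at h2
      exact h2 ▸ hk
    · dsimp only
      rw [Set.Finite.coe_toFinset]
      exact hcone J

end IsLatticeFan

end Product

end ToricFan

theorem mainTheorem5 {N : Type*} [AddCommGroup N] [Module.Free ℤ N] [Module.Finite ℤ N]
    (Δ : Set (PointedCone ℝ (ToricFan.RealSpace N))) (hfan : ToricFan.IsFan Δ)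
    (hcomplete : ToricFan.IsComplete Δ) (hnonsing : ToricFan.IsNonsingular Δ) :
    (ToricFan.FanoWithSubvarietiesAndBlowDowns Δ ↔ ToricFan.HasSimplePrimitiveRelations Δ) ∧
    (ToricFan.FanoWithSubvarietiesAndBlowDowns Δ ∧ ToricFan.HasSimplePrimitiveRelations Δ →
      ∃ Δ₀ : Set (PointedCone ℝ (ToricFan.RealSpace N)),
        ToricFan.IsProductOfProjectiveSpaces Δ₀ ∧
        ∀ l : List N, l.Nodup →
          (∀ ρ : N, ρ ∈ l ↔
            ToricFan.IsRayGenerator Δ ρ ∧ ¬ ToricFan.IsRayGenerator Δ₀ ρ) →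
          ∃ Γ : Fin (l.length + 1) → Set (PointedCone ℝ (ToricFan.RealSpace N)),
            Γ 0 = Δ ∧ Γ (Fin.last l.length) = Δ₀ ∧
            (∀ i : Fin l.length, ToricFan.IsBlowUp (Γ i.castSucc) (Γ i.succ) (l.get i)) ∧
            ∀ i : Fin (l.length + 1),
              ToricFan.IsFan (Γ i) ∧ ToricFan.IsComplete (Γ i) ∧ ToricFan.IsNonsingular (Γ i) ∧
              ToricFan.FanoWithSubvarietiesAndBlowDowns (Γ i) ∧
              ToricFan.HasSimplePrimitiveRelations (Γ i)) := by
  obtain ⟨K, hK, rfl⟩ := ToricFan.exists_isLatticeFan hfan hcomplete hnonsing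
  refine ⟨hK.fano_iff, fun ⟨_, hrel⟩ => ?_⟩
  obtain ⟨hs, hd⟩ := hK.hasSimplePrimitiveRelations_iff.1 hrel
  have hsimple : ToricFan.IsSimpleFan K := ⟨hK, hs, hd⟩
  obtain ⟨K₀, hc, hK₀, h0⟩ := hsimple.exists_contractsTo
  refine ⟨ToricFan.fanOf K₀, hK₀.isLatticeFan.isProductOfProjectiveSpaces h0, fun l hl hmem => ?_⟩
  obtain ⟨Γ, hΓ0, hΓlast, hΓ, hΓs⟩ :=
    ToricFan.ContractsTo.exists_sequence l hl hc hsimple fun ρ => by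
      rw [hmem, hK.isRayGenerator_iff, hK₀.isLatticeFan.isRayGenerator_iff]
  refine ⟨fun i => ToricFan.fanOf (Γ i), congrArg _ hΓ0, congrArg _ hΓlast,
    fun i => ?_, fun i => ?_⟩
  · exact ((hΓs _).isLatticeFan.isBlowUp_iff (hΓs _).isLatticeFan).2 (hΓ i)
  · have h := hΓs i
    have hr := h.isLatticeFan.hasSimplePrimitiveRelations_iff.2
      ⟨h.hasShortRelations, h.hasDistinctSums⟩
    exact ⟨h.isLatticeFan.isFan, h.isLatticeFan.isComplete, h.isLatticeFan.isNonsingular,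
      h.isLatticeFan.fano_iff.2 hr, hr⟩
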